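/- **Theorem 3.1 (Reduction).** *Setting.* Let $X$ be a measurable space with countably generated $\sigma$-algebra, $\nu$ a $\sigma$-finite measure on $X$ (for instance $X=\mathbb R^d$ with Lebesgue measure), and $\mathcal F$ a non-empty class of probability measures on $X$ that have densities with respect to $\nu$. Let $d_{TV}(P,Q)=\sup_A|P(A)-Q(A)|=\frac12\int|\frac{dP}{d\nu}-\frac{dQ}{d\nu}|\,d\nu$. A randomized algorithm is a Markov kernel from inputs to outputs, where sets of probability measures carry the $\sigma$-algebra generated by the evaluations $P\mapsto P(A)$, and lists and mixtures the induced ones. * $\mathcal F$ admits a $(t,\gamma)$-locally small $\rho$-cover ($\gamma\ge\rho$) if there is $C\subseteq\mathcal F$ such that every $f\in\mathcal F$ has an $f'\in C$ with $d_{TV}(f,f')\le\rho$, and $|\{f'\in C: d_{TV}(f',f)\le\gamma\}|\le t$ for every $f\in\mathcal F$. * $\mathcal F$ is $(L,m,\rho,\beta',\gamma)$-list-decodable if some randomized algorithm that receives $m$ i.i.d. samples from $(1-\gamma)f+\gamma h$ outputs a list of at most $L$ members of $\mathcal F$ which, for every $f\in\mathcal F$ and every probability measure $h$, contains with probability at least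 $1-\beta'$ some $\hat f$ with $d_{TV}(\hat f,f)\le\rho$. * $k\text{-mix}(\mathcal F)=\Delta_k\times\mathcal F^k$, where $\Delta_k$ is the probability simplex and $(w,(f_i))$ stands for the distribution $\sum_i w_if_i$; distances between mixtures are TV distances between these distributions. * A randomized algorithm $M$ on $X^n$ is $(\varepsilon,\delta)$-DP if $\Pr[M(D)\in E]\le e^{\varepsilon}\Pr[M(D')\in E]+\delta$ for all $D,D'\in X^n$ that differ in one entry and all measurable $E$. It is an $(\alpha,\beta)$-PAC-learner of $k\text{-mix}(\mathcal F)$ with $n$ samples if it outputs a member of $k\text{-mix}(\mathcal F)$ and, for every $f\in k\text{-mix}(\mathcal F)$, on $n$ i.i.d. samples from $f$ the output is within TV distance $\alpha$ of $f$ with probability at least $1-\beta$. For integers $t,L,m,k$ with $m,k\ge1$, and $\alpha,\beta\in(0,1)$, $\varepsilon>0$, $\delta\in(0,1]$, put $$\Lambda=1+\log\left(\frac1\beta\max\left\{1,\frac{mk\,(1+\log\frac{tL}{\alpha\delta})}{\varepsilon}\right\}\right),$$ $$N=\max\left\{1,\ \frac{\log(1/\delta)+k\log(tL)}{\varepsilon}+\frac{mk+k\log(1/\beta)}{\alpha\varepsilon}\right\}\cdot\left(\frac{k\log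 L}{\alpha^2}+\frac{mk+k\log(1/\beta)}{\alpha^3}\right).$$ *Claim.* For all $a>0$ and $p\in\mathbb N$ there are $C>0$ and $q\in\mathbb N$, depending on $a$ and $p$ only, such that the following holds for all $X,\nu,\mathcal F,t,L,m,k,\alpha,\beta,\varepsilon,\delta$ as above and all $\beta'\in(0,1)$ with $\Lambda\le a\,\log(1/\beta')\,\log^p(2+\Lambda)$, that is, $\log(1/\beta')=\widetilde\Omega(\Lambda)$ (so in particular whenever $\log(1/\beta')=\widetilde\Theta(\Lambda)$). If $\mathcal F$ admits a $(t,2\alpha/15)$-locally small $\frac{\alpha}{15}$-cover and is $(L,m,\alpha/15,\beta',0)$-list-decodable, then $k\text{-mix}(\mathcal F)$ has an $(\varepsilon,\delta)$-DP $(\alpha,\beta)$-PAC-learner with some number $$n\le C\,N\log^q(2+N)=\widetilde O(N)$$ of samples. -/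

import Mathlib

open MeasureTheory ProbabilityTheory
open scoped ENNReal

noncomputable section

/-! ### Total variation distance -/

/-- Total variation distance between two probability measures,
`sup_A |P(A) - Q(A)|` over the measurable sets `A`. -/
def tvDist {X : Type*} [MeasurableSpace X] (P Q : ProbabilityMeasure X) : ℝ :=
  ⨆ A : {A : Set X // MeasurableSet A},
    |(P : Measure X).real A.1 - (Q : Measure X).real A.1|

/-- For distributions with densities with respect to a σ-finite reference measure, the total
variation distance is half the `L¹` distance of the densities. -/
theorem tvDist_eq_half_integral {X : Type*} [MeasurableSpace X] (ν : Measure X) [SigmaFinite ν]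
    (P Q : ProbabilityMeasure X) (hP : (P : Measure X) ≪ ν) (hQ : (Q : Measure X) ≪ ν) :
    tvDist P Q = (1 / 2) * ∫ x, |((P : Measure X).rnDeriv ν x).toReal
      - ((Q : Measure X).rnDeriv ν x).toReal| ∂ν := by
  set d : X → ℝ := fun x => ((P : Measure X).rnDeriv ν x).toReal
      - ((Q : Measure X).rnDeriv ν x).toReal with hd
  have hPi : Integrable (fun x => ((P : Measure X).rnDeriv ν x).toReal) ν :=
    Measure.integrable_toReal_rnDeriv
  have hQi : Integrable (fun x => ((Q : Measure X).rnDeriv ν x).toReal) ν :=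
    Measure.integrable_toReal_rnDeriv
  have hdi : Integrable d ν := hPi.sub hQi
  have hset : ∀ A : Set X, MeasurableSet A →
      (P : Measure X).real A - (Q : Measure X).real A = ∫ x in A, d x ∂ν := by
    intro A _
    rw [hd, integral_sub hPi.integrableOn hQi.integrableOn,
      Measure.setIntegral_toReal_rnDeriv hP, Measure.setIntegral_toReal_rnDeriv hQ]
  have hzero : ∫ x, d x ∂ν = 0 := by
    have h := hset Set.univ MeasurableSet.univ
    simpa using h.symm
  have hcompl : ∀ A : Set X, MeasurableSet A →
      2 * ∫ x in A, d x ∂ν = (∫ x in A, d x ∂ν) - ∫ x in Aᶜ, d x ∂ν := by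
    intro A hA
    have h := integral_add_compl hA hdi
    linarith
  have habs : ∀ A : Set X, MeasurableSet A →
      (∫ x in A, |d x| ∂ν) + ∫ x in Aᶜ, |d x| ∂ν = ∫ x, |d x| ∂ν :=
    fun A hA => integral_add_compl hA hdi.abs
  have hub : ∀ A : Set X, MeasurableSet A →
      |(P : Measure X).real A - (Q : Measure X).real A| ≤ (1 / 2) * ∫ x, |d x| ∂ν := by
    intro A hA
    rw [hset A hA]
    have h1 : |∫ x in A, d x ∂ν| ≤ ∫ x in A, |d x| ∂ν := abs_integral_le_integral_abs
    have h2 : |∫ x in Aᶜ, d x ∂ν| ≤ ∫ x in Aᶜ, |d x| ∂ν := abs_integral_le_integral_abs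
    have h3 := hcompl A hA
    have h4 := habs A hA
    rw [abs_le] at h1 h2 ⊢
    constructor <;> linarith [h1.1, h1.2, h2.1, h2.2]
  have hbdd : BddAbove (Set.range fun A : {A : Set X // MeasurableSet A} =>
      |(P : Measure X).real A.1 - (Q : Measure X).real A.1|) :=
    ⟨_, by rintro _ ⟨A, rfl⟩; exact hub A.1 A.2⟩
  have hdm : Measurable d :=
    ((Measure.measurable_rnDeriv _ _).ennreal_toReal).sub
      ((Measure.measurable_rnDeriv _ _).ennreal_toReal)
  have hA : MeasurableSet {x | 0 ≤ d x} := measurableSet_le measurable_const hdm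
  apply le_antisymm
  · have : Nonempty {A : Set X // MeasurableSet A} := ⟨⟨∅, MeasurableSet.empty⟩⟩
    exact ciSup_le fun A => hub A.1 A.2
  · refine le_trans ?_ (le_ciSup hbdd ⟨{x | 0 ≤ d x}, hA⟩)
    refine le_trans ?_ (le_abs_self _)
    simp only []
    rw [hset _ hA]
    have h1 : ∫ x in {x | 0 ≤ d x}, |d x| ∂ν = ∫ x in {x | 0 ≤ d x}, d x ∂ν :=
      setIntegral_congr_fun hA fun x hx => abs_of_nonneg hx
    have h2 : ∫ x in {x | 0 ≤ d x}ᶜ, |d x| ∂ν = -∫ x in {x | 0 ≤ d x}ᶜ, d x ∂ν := by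
      rw [← integral_neg]
      exact setIntegral_congr_fun hA.compl fun x hx => abs_of_neg (not_le.mp hx)
    have h3 := hcompl _ hA
    have h4 := habs _ hA
    linarith

/-! ### Covers

A class of distributions is given by a type `Θ` of members together with the distribution
`law f` of each member `f`. For a set `F` of probability measures, `Θ = F` and `law` is the
inclusion; for mixtures, a member is a representation (weights and components). -/

/-- The total variation distance between the distributions of two members of a class. -/
def tvOn {Θ X : Type*} [MeasurableSpace X] (law : Θ → ProbabilityMeasure X) (f g : Θ) : ℝ :=
  tvDist (law f) (law g)

/-- `C` is an `α`-cover of the class with respect to `κ`. -/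
def IsCover {Θ : Type*} (κ : Θ → Θ → ℝ) (α : ℝ) (C : Set Θ) : Prop :=
  ∀ f : Θ, ∃ f' ∈ C, κ f f' ≤ α

/-- Every closed `κ`-ball of radius `γ` around a member of the class contains at most `t`
elements of `C`. -/
def IsLocallySmall {Θ : Type*} (κ : Θ → Θ → ℝ) (t : ℕ) (γ : ℝ) (C : Set Θ) : Prop :=
  ∀ f : Θ, {f' ∈ C | κ f' f ≤ γ}.encard ≤ t

/-- The class admits a `(t, γ)`-locally small `α`-cover with respect to `κ`. -/
def AdmitsLocallySmallCover {Θ : Type*} (κ : Θ → Θ → ℝ) (t : ℕ) (γ α : ℝ) : Prop :=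
  α ≤ γ ∧ ∃ C : Set Θ, IsCover κ α C ∧ IsLocallySmall κ t γ C

/-! ### Mixtures -/

/-- `k`-mixtures of a class: a weight vector in the probability simplex and `k` components. -/
abbrev KMix (k : ℕ) (Θ : Type*) : Type _ := stdSimplex ℝ (Fin k) × (Fin k → Θ)

/-- The distribution `∑ i, w i • f i` of a `k`-mixture. -/
def mixLaw {Θ X : Type*} [MeasurableSpace X] (law : Θ → ProbabilityMeasure X) (k : ℕ)
    (g : KMix k Θ) : ProbabilityMeasure X :=
  ⟨∑ i, ENNReal.ofReal (g.1.1 i) • (law (g.2 i) : Measure X), ⟨by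
    have h0 : ∀ i, 0 ≤ g.1.1 i := g.1.2.1
    have h1 : ∑ i, g.1.1 i = 1 := g.1.2.2
    simp only [Measure.coe_finsetSum, Finset.sum_apply, Measure.smul_apply, measure_univ,
      smul_eq_mul, mul_one]
    rw [← ENNReal.ofReal_sum_of_nonneg fun i _ => h0 i, h1, ENNReal.ofReal_one]⟩⟩

/-! ### Learning

A randomized algorithm with inputs in `I` and outputs in `O` is a Markov kernel from `I` to `O`.
The probability that an algorithm `A` run on a random input of law `μ` produces an output in a
set `E` is `(A ∘ₘ μ) E`. Sets of probability measures carry the σ-algebra generated by the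
evaluations `P ↦ P A`, and lists and mixtures the σ-algebras built from it. -/

/-- Lists of at most `L` members of the class. -/
abbrev ListUpTo (L : ℕ) (Θ : Type*) : Type _ := Σ n : Fin (L + 1), Fin n.1 → Θ

/-- The contaminated distribution `(1 - γ) f + γ h`. -/
def huber {X : Type*} [MeasurableSpace X] (γ : ℝ) (f h : ProbabilityMeasure X) : Measure X :=
  ENNReal.ofReal (1 - γ) • (f : Measure X) + ENNReal.ofReal γ • (h : Measure X)

/-- `A` is an `(L, m, α, β, γ)`-list-decoding algorithm with respect to `κ`: on `m` i.i.d. samples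
from `(1 - γ) f + γ h`, the event that no member of the output list is `α`-close to `f` has
probability at most `β`. -/
def IsListDecoder {Θ X : Type*} [MeasurableSpace X] [MeasurableSpace Θ]
    (law : Θ → ProbabilityMeasure X) (κ : Θ → Θ → ℝ) (L m : ℕ) (α β γ : ℝ)
    (A : Kernel (Fin m → X) (ListUpTo L Θ)) : Prop :=
  ∀ (f : Θ) (h : ProbabilityMeasure X),
    (A ∘ₘ Measure.pi fun _ : Fin m => huber γ (law f) h)
      {l | ¬ ∃ i, κ (l.2 i) f ≤ α} ≤ ENNReal.ofReal β

/-- The class is `(L, m, α, β, γ)`-list-decodable with respect to `κ`. -/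
def IsListDecodable {Θ X : Type*} [MeasurableSpace X] [MeasurableSpace Θ]
    (law : Θ → ProbabilityMeasure X) (κ : Θ → Θ → ℝ) (L m : ℕ) (α β γ : ℝ) : Prop :=
  ∃ A : Kernel (Fin m → X) (ListUpTo L Θ), IsMarkovKernel A ∧ IsListDecoder law κ L m α β γ A

/-- `A` is an `(α, β)`-PAC-learner with `n` samples with respect to `κ`: on `n` i.i.d. samples
from `f`, the event that the output is not `α`-close to `f` has probability at most `β`. -/
def IsPACLearner {Θ X : Type*} [MeasurableSpace X] [MeasurableSpace Θ]
    (law : Θ → ProbabilityMeasure X) (κ : Θ → Θ → ℝ) (n : ℕ) (α β : ℝ)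
    (A : Kernel (Fin n → X) Θ) : Prop :=
  ∀ f : Θ, (A ∘ₘ Measure.pi fun _ : Fin n => (law f : Measure X))
    {g | ¬ κ f g ≤ α} ≤ ENNReal.ofReal β

/-! ### Differential privacy -/

/-- `(ε, δ)`-indistinguishability of two distributions. -/
def Indistinguishable {O : Type*} [MeasurableSpace O] (ε δ : ℝ) (μ μ' : Measure O) : Prop :=
  ∀ E : Set O, MeasurableSet E →
    μ E ≤ ENNReal.ofReal (Real.exp ε) * μ' E + ENNReal.ofReal δ ∧
    μ' E ≤ ENNReal.ofReal (Real.exp ε) * μ E + ENNReal.ofReal δ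

/-- Two datasets are neighbouring if they differ in (at most) one entry. -/
def Neighbouring {X : Type*} {n : ℕ} (D D' : Fin n → X) : Prop :=
  ∃ i, ∀ j, j ≠ i → D j = D' j

/-- `(ε, δ)`-differential privacy of a randomized algorithm. -/
def IsDP {X O : Type*} [MeasurableSpace X] [MeasurableSpace O] {n : ℕ} (ε δ : ℝ)
    (M : Kernel (Fin n → X) O) : Prop :=
  ∀ D D' : Fin n → X, Neighbouring D D' → Indistinguishable ε δ (M D) (M D')

/-- The class has an `(ε, δ)`-DP `(α, β)`-PAC-learner with `n` samples. -/
def IsDPPACLearnableWith {Θ X : Type*} [MeasurableSpace X] [MeasurableSpace Θ]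
    (law : Θ → ProbabilityMeasure X) (κ : Θ → Θ → ℝ) (n : ℕ) (ε δ α β : ℝ) : Prop :=
  ∃ A : Kernel (Fin n → X) Θ, IsMarkovKernel A ∧ IsDP ε δ A ∧ IsPACLearner law κ n α β A

/-! ### The quantities in the reduction -/

/-- The order of `log (1 / β')`: for `ε ≤ m k (1 + log (t L / (α δ)))` this is
`1 + log (m k (1 + log (t L / (α δ))) / (ε β))`. -/
def confidenceExponent (t L m k : ℕ) (α β ε δ : ℝ) : ℝ :=
  1 + Real.log (max 1 (m * k * (1 + Real.log (t * L / (α * δ))) / ε) / β)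

/-- The sample complexity of the reduction without the polylogarithmic factors. The first factor
is the number of disjoint data sets, which is at least one. -/
def reductionComplexity (t L m k : ℕ) (α β ε δ : ℝ) : ℝ :=
  max 1 ((Real.log (1 / δ) + k * Real.log (t * L)) / ε
      + (m * k + k * Real.log (1 / β)) / (α * ε))
    * (k * Real.log L / α ^ 2 + (m * k + k * Real.log (1 / β)) / α ^ 3)

end

/-! The data are cut into `T` disjoint blocks, a finite set of candidate mixtures is computed on
each block without regard to privacy, and one element is selected privately from the `T` sets. The
selection works because for every target `f` there is a candidate `h₀`, depending on `f` alone, that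
with high probability occurs in the sets of all blocks, while all candidates in these sets are
`α`-close to `f`.

On a block the list decoder is run on all `m`-tuples of `s` samples. A component of weight at least
`1 / G` supplies many disjoint tuples drawn from it alone, so that some run succeeds on it except
with probability about `β' ^ r` (`allTuplesKernel_mixture_le`); lighter components receive weight
zero in the net of `exists_simplex_net`. The lists differ from block to block, so their members are
rounded to the cover. With `ρ = α / 15`, a cover point `ρ`-close to a component is `2ρ`-close to
every list member that is `ρ`-close to this component. Recording all of the at most `t` cover points
within `2ρ` of each list member therefore produces the same cover point in every block
(`exists_mem_roundFinset`).

A minimum distance test on `s'` further samples discards the mixtures far from `f`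
(`candidates_spec`). It is applied to one representative for each list member, and the recorded
alternatives are substituted only afterwards. This costs another `3ρ` in accuracy, but keeps `t` out
of the union bound and hence out of the size of a block.

For the selection, a candidate found in `n` of the sets has weight `exp (η n) - 1`, and a default
output has weight `W`. Replacing one block changes weights by a factor `exp η`, up to an additive
error on at most `b` candidates, which a large `W` turns into `δ` (`selMeasure_le_of_eq_off`). As
`h₀` has weight `exp (η T) - 1`, the default is rare once `T` is, up to constants, at least `1 + log
(b / (β δ)) / ε` (`selMeasure_default_le`).

Measurability is manageable because the cover is countable: dominated classes are separable in total
variation (`IsLocallySmall.countable`), so sets of candidates live in a countable space. The lower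
bound on `log (1 / β')` makes polylogarithmically many repetitions `r` sufficient. -/

noncomputable section

/-! ### Total variation: measurability, separability, mixtures -/

section TotalVariation

variable {X : Type*} [MeasurableSpace X]

theorem abs_real_sub_real_le_one (P Q : ProbabilityMeasure X) (A : Set X) :
    |(P : Measure X).real A - (Q : Measure X).real A| ≤ 1 := by
  have h1 : (P : Measure X).real A ≤ 1 := measureReal_le_one
  have h2 : (Q : Measure X).real A ≤ 1 := measureReal_le_one
  have h3 : 0 ≤ (P : Measure X).real A := measureReal_nonneg
  have h4 : 0 ≤ (Q : Measure X).real A := measureReal_nonneg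
  rw [abs_le]; constructor <;> linarith

theorem bddAbove_tvDist (P Q : ProbabilityMeasure X) :
    BddAbove (Set.range fun A : {A : Set X // MeasurableSet A} =>
      |(P : Measure X).real A.1 - (Q : Measure X).real A.1|) :=
  ⟨1, by rintro _ ⟨A, rfl⟩; exact abs_real_sub_real_le_one P Q A.1⟩

instance nonempty_measurableSets : Nonempty {A : Set X // MeasurableSet A} :=
  ⟨⟨∅, MeasurableSet.empty⟩⟩

theorem abs_real_sub_real_le_tvDist (P Q : ProbabilityMeasure X) {A : Set X}
    (hA : MeasurableSet A) :
    |(P : Measure X).real A - (Q : Measure X).real A| ≤ tvDist P Q :=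
  le_ciSup (bddAbove_tvDist P Q) ⟨A, hA⟩

theorem tvDist_le {P Q : ProbabilityMeasure X} {c : ℝ}
    (h : ∀ A, MeasurableSet A → |(P : Measure X).real A - (Q : Measure X).real A| ≤ c) :
    tvDist P Q ≤ c :=
  ciSup_le fun A => h A.1 A.2

theorem tvDist_self (P : ProbabilityMeasure X) : tvDist P P = 0 := by
  simp [tvDist]

theorem tvDist_comm (P Q : ProbabilityMeasure X) : tvDist P Q = tvDist Q P := by
  simp only [tvDist, abs_sub_comm]

theorem tvDist_triangle (P Q R : ProbabilityMeasure X) :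
    tvDist P R ≤ tvDist P Q + tvDist Q R :=
  tvDist_le fun A hA => (abs_sub_le _ ((Q : Measure X).real A) _).trans
    (add_le_add (abs_real_sub_real_le_tvDist P Q hA) (abs_real_sub_real_le_tvDist Q R hA))

/-- A measurable set that nearly attains the total variation distance. -/
theorem exists_set_tvDist_lt (P Q : ProbabilityMeasure X) {η : ℝ} (hη : 0 < η) :
    ∃ A, MeasurableSet A ∧
      tvDist P Q < |(P : Measure X).real A - (Q : Measure X).real A| + η := by
  obtain ⟨A, hA⟩ := exists_lt_of_lt_ciSup (show tvDist P Q - η < tvDist P Q by linarith)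
  exact ⟨A.1, A.2, by linarith⟩

theorem measurable_real_apply {A : Set X} (hA : MeasurableSet A) :
    Measurable fun P : ProbabilityMeasure X => (P : Measure X).real A :=
  ((Measure.measurable_coe hA).comp measurable_subtype_coe).ennreal_toReal

/-- A countable family of measurable sets that computes all total variation distances. -/
theorem exists_countable_tvDist_eq [MeasurableSpace.CountablyGenerated X] :
    ∃ 𝒜 : Set (Set X), 𝒜.Countable ∧ 𝒜.Nonempty ∧ (∀ A ∈ 𝒜, MeasurableSet A) ∧
      ∀ P Q : ProbabilityMeasure X,
        tvDist P Q = ⨆ A : 𝒜, |(P : Measure X).real A.1 - (Q : Measure X).real A.1| := by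
  set 𝒜 := generateSetAlgebra (MeasurableSpace.countableGeneratingSet X) with h𝒜
  have hgen : ‹MeasurableSpace X› = MeasurableSpace.generateFrom 𝒜 := by
    rw [h𝒜, generateFrom_generateSetAlgebra_eq,
      MeasurableSpace.generateFrom_countableGeneratingSet]
  have halg : IsSetAlgebra 𝒜 := isSetAlgebra_generateSetAlgebra
  have hmeas : ∀ A ∈ 𝒜, MeasurableSet A := fun A hA => by
    rw [hgen]; exact MeasurableSpace.measurableSet_generateFrom hA
  refine ⟨𝒜, countable_generateSetAlgebra MeasurableSpace.countable_countableGeneratingSet,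
    ⟨∅, halg.empty_mem⟩, hmeas, fun P Q => ?_⟩
  have : Nonempty 𝒜 := ⟨⟨∅, halg.empty_mem⟩⟩
  have hbdd : BddAbove (Set.range fun A : 𝒜 =>
      |(P : Measure X).real A.1 - (Q : Measure X).real A.1|) :=
    ⟨1, by rintro _ ⟨A, rfl⟩; exact abs_real_sub_real_le_one P Q A.1⟩
  apply le_antisymm
  · refine tvDist_le fun A hA => le_of_forall_pos_le_add fun η hη => ?_
    -- Approximation with respect to the sum of the two measures makes the symmetric difference
    -- small for both at once.
    have hd := Measure.MeasureDense.of_generateFrom_isSetAlgebra_finite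
      ((P : Measure X) + (Q : Measure X)) halg hgen
    obtain ⟨B, hB, hAB⟩ := hd.approx A hA (measure_ne_top _ _) η hη
    have h1 : |(P : Measure X).real A - (P : Measure X).real B| ≤
        (P : Measure X).real (symmDiff A B) :=
      abs_measureReal_sub_le_measureReal_symmDiff hA.nullMeasurableSet
        (hmeas B hB).nullMeasurableSet
    have h2 : |(Q : Measure X).real A - (Q : Measure X).real B| ≤
        (Q : Measure X).real (symmDiff A B) :=
      abs_measureReal_sub_le_measureReal_symmDiff hA.nullMeasurableSet
        (hmeas B hB).nullMeasurableSet
    have h3 : (P : Measure X).real (symmDiff A B) + (Q : Measure X).real (symmDiff A B) ≤ η := by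
      rw [← measureReal_add_apply]
      exact ENNReal.toReal_le_of_le_ofReal hη.le hAB.le
    have h4 := le_ciSup hbdd ⟨B, hB⟩
    simp only at h4
    rw [abs_le] at h1 h2 h4 ⊢
    constructor <;> linarith [h1.1, h1.2, h2.1, h2.2, h4.1, h4.2]
  · exact ciSup_le fun A => abs_real_sub_real_le_tvDist P Q (hmeas A.1 A.2)

/-- The supremum in the definition is uncountable; measurability comes from replacing it by the
countable one. -/
theorem measurable_tvDist [MeasurableSpace.CountablyGenerated X] (Q : ProbabilityMeasure X) :
    Measurable fun P : ProbabilityMeasure X => tvDist P Q := by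
  obtain ⟨𝒜, hc, hne, hm, h⟩ := exists_countable_tvDist_eq (X := X)
  have := hc.to_subtype
  simp only [h]
  refine Measurable.iSup fun A => ?_
  exact ((measurable_real_apply (hm A.1 A.2)).sub_const _).abs

/-- A family of distributions dominated by a `σ`-finite measure on a countably generated space is
separable in total variation. -/
theorem exists_countable_tvDist_dense [MeasurableSpace.CountablyGenerated X] (ν : Measure X)
    [SigmaFinite ν] {Θ : Type*} (law : Θ → ProbabilityMeasure X)
    (hν : ∀ f, (law f : Measure X) ≪ ν) {η : ℝ} (hη : 0 < η) :
    ∃ D : Set Θ, D.Countable ∧ ∀ f, ∃ d ∈ D, tvDist (law f) (law d) ≤ η := by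
  have hint : ∀ f, Integrable (fun x => ((law f : Measure X).rnDeriv ν x).toReal) ν :=
    fun f => Measure.integrable_toReal_rnDeriv
  -- Densities embed the class into `L¹`, which is separable as the σ-algebra is countably
  -- generated.
  set ψ : Θ → Lp ℝ 1 ν := fun f => (hint f).toL1 _ with hψ
  have hdist : ∀ f g, tvDist (law f) (law g) ≤ dist (ψ f) (ψ g) := by
    intro f g
    rw [tvDist_eq_half_integral ν _ _ (hν f) (hν g), dist_eq_norm, hψ]
    simp only
    rw [← Integrable.toL1_sub, L1.norm_of_fun_eq_integral_norm]
    simp only [Pi.sub_apply, Real.norm_eq_abs]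
    have : 0 ≤ ∫ x, |((law f : Measure X).rnDeriv ν x).toReal
        - ((law g : Measure X).rnDeriv ν x).toReal| ∂ν :=
      integral_nonneg fun x => abs_nonneg _
    linarith
  have : Fact ((1 : ℝ≥0∞) ≠ ∞) := ⟨ENNReal.one_ne_top⟩
  have : SecondCountableTopology (Lp ℝ 1 ν) := Lp.SecondCountableTopology
  -- Density is taken inside the range of `ψ`, so that the approximating points come from members of
  -- the class.
  obtain ⟨D, hD, hdense⟩ := TopologicalSpace.exists_countable_dense (Set.range ψ)
  refine ⟨(fun y : Set.range ψ => y.2.choose) '' D, hD.image _, fun f => ?_⟩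
  obtain ⟨y, hyD, hy⟩ := Metric.mem_closure_iff.1 (hdense ⟨ψ f, f, rfl⟩) η hη
  refine ⟨_, ⟨y, hyD, rfl⟩, (hdist _ _).trans ?_⟩
  simp only [y.2.choose_spec]
  exact hy.le

/-- Countably many balls of radius `γ` around a dense set cover `C`, and each of them meets `C` in a
finite set. -/
theorem IsLocallySmall.countable [MeasurableSpace.CountablyGenerated X] (ν : Measure X)
    [SigmaFinite ν] {Θ : Type*} {law : Θ → ProbabilityMeasure X}
    (hν : ∀ f, (law f : Measure X) ≪ ν) {t : ℕ} {γ : ℝ} (hγ : 0 < γ) {C : Set Θ}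
    (hC : IsLocallySmall (tvOn law) t γ C) : C.Countable := by
  obtain ⟨D, hD, hdense⟩ := exists_countable_tvDist_dense ν law hν hγ
  have : C ⊆ ⋃ d ∈ D, {c ∈ C | tvOn law c d ≤ γ} := by
    intro c hc
    obtain ⟨d, hd, hcd⟩ := hdense c
    exact Set.mem_biUnion hd ⟨hc, hcd⟩
  refine (hD.biUnion fun d _ => ?_).mono this
  refine Set.Finite.countable (Set.encard_ne_top_iff.1 ((hC d).trans_lt ?_).ne)
  exact WithTop.coe_lt_top t

theorem mixLaw_real {Θ : Type*} (law : Θ → ProbabilityMeasure X) (k : ℕ) (g : KMix k Θ)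
    (A : Set X) :
    (mixLaw law k g : Measure X).real A = ∑ i, g.1.1 i * (law (g.2 i) : Measure X).real A := by
  have h0 : ∀ i, 0 ≤ g.1.1 i := g.1.2.1
  simp only [mixLaw, ProbabilityMeasure.coe_mk, measureReal_def, Measure.coe_finsetSum,
    Finset.sum_apply, Measure.smul_apply, smul_eq_mul]
  rw [ENNReal.toReal_sum fun i _ => ENNReal.mul_ne_top ENNReal.ofReal_ne_top (measure_ne_top _ _)]
  exact Finset.sum_congr rfl fun i _ => by rw [ENNReal.toReal_mul, ENNReal.toReal_ofReal (h0 i)]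

/-- Two mixtures are close if their weights are close and the components that matter for the
second one are close. -/
theorem tvDist_mixLaw_le {Θ Θ' : Type*} (law : Θ → ProbabilityMeasure X)
    (law' : Θ' → ProbabilityMeasure X) (k : ℕ) (g : KMix k Θ) (g' : KMix k Θ') {η η' : ℝ}
    (hw : ∑ i, |g.1.1 i - g'.1.1 i| ≤ η)
    (hc : ∀ i, 0 < g'.1.1 i → tvDist (law (g.2 i)) (law' (g'.2 i)) ≤ η') :
    tvDist (mixLaw law k g) (mixLaw law' k g') ≤ η + η' := by
  refine tvDist_le fun A hA => ?_
  rw [mixLaw_real, mixLaw_real, ← Finset.sum_sub_distrib]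
  have h0 : ∀ i, 0 ≤ g'.1.1 i := g'.1.2.1
  have h1 : ∑ i, g'.1.1 i = 1 := g'.1.2.2
  calc |∑ i, (g.1.1 i * (law (g.2 i) : Measure X).real A
        - g'.1.1 i * (law' (g'.2 i) : Measure X).real A)|
      ≤ ∑ i, |g.1.1 i * (law (g.2 i) : Measure X).real A
        - g'.1.1 i * (law' (g'.2 i) : Measure X).real A| := Finset.abs_sum_le_sum_abs _ _
    _ ≤ ∑ i, (|g.1.1 i - g'.1.1 i| + g'.1.1 i * η') := by
        refine Finset.sum_le_sum fun i _ => ?_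
        -- The difference of the components is weighted by `g'`, so components of weight zero in
        -- `g'` are unconstrained.
        have e : g.1.1 i * (law (g.2 i) : Measure X).real A
            - g'.1.1 i * (law' (g'.2 i) : Measure X).real A
            = (g.1.1 i - g'.1.1 i) * (law (g.2 i) : Measure X).real A + g'.1.1 i *
              ((law (g.2 i) : Measure X).real A - (law' (g'.2 i) : Measure X).real A) := by ring
        rw [e]
        refine (abs_add_le _ _).trans (add_le_add ?_ ?_)
        · rw [abs_mul, abs_of_nonneg (measureReal_nonneg (s := A))]
          exact mul_le_of_le_one_right (abs_nonneg _) measureReal_le_one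
        · rw [abs_mul, abs_of_nonneg (h0 i)]
          rcases (h0 i).eq_or_lt with h | h
          · rw [← h]; simp
          · exact mul_le_mul_of_nonneg_left
              ((abs_real_sub_real_le_tvDist _ _ hA).trans (hc i h)) (h0 i)
    _ = ∑ i, |g.1.1 i - g'.1.1 i| + η' := by
        rw [Finset.sum_add_distrib, ← Finset.sum_mul, h1, one_mul]
    _ ≤ η + η' := by linarith

theorem measurable_mixLaw {Θ : Type*} [MeasurableSpace Θ] {law : Θ → ProbabilityMeasure X}
    (hlaw : Measurable law) (k : ℕ) : Measurable (mixLaw law k) := by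
  refine Measurable.subtype_mk (Measure.measurable_of_measurable_coe _ fun A hA => ?_)
  simp only [Measure.coe_finsetSum, Finset.sum_apply, Measure.smul_apply, smul_eq_mul]
  refine Finset.measurable_sum _ fun i _ => Measurable.mul ?_ ?_
  · exact ((measurable_pi_apply i).comp (measurable_subtype_coe.comp measurable_fst)).ennreal_ofReal
  · exact (Measure.measurable_coe hA).comp (measurable_subtype_coe.comp
      (hlaw.comp ((measurable_pi_apply i).comp measurable_snd)))

end TotalVariation

/-! ### A finite net of the simplex -/

section Grid

/-- A finite net of the simplex in the `ℓ¹` distance whose approximations only charge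
coordinates of substantial weight. -/
theorem exists_simplex_net {k G : ℕ} (hk : 0 < k) (hG : k ≤ G) :
    ∃ W : Finset (stdSimplex ℝ (Fin k)), W.Nonempty ∧ W.card ≤ (G + 1) ^ k ∧
      ∀ w : stdSimplex ℝ (Fin k), ∃ v ∈ W, ∑ i, |w.1 i - v.1 i| ≤ 2 * k / G ∧
        ∀ i, 0 < v.1 i → 1 / G ≤ w.1 i := by
  classical
  have : Nonempty (Fin k) := ⟨⟨0, hk⟩⟩
  have hG0 : 0 < (G : ℝ) := by exact_mod_cast hk.trans_le hG
  -- Integer vectors of sum `G` are scaled to the simplex; all others go to a vertex, a junk value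
  -- that leaves the count at `(G + 1) ^ k`.
  set g : (Fin k → Fin (G + 1)) → stdSimplex ℝ (Fin k) := fun n =>
    if h : ∑ i, ((n i : ℕ) : ℝ) = G then
      ⟨fun i => ((n i : ℕ) : ℝ) / G, fun i => by positivity, by
        rw [← Finset.sum_div, h, div_self hG0.ne']⟩
    else ⟨Pi.single ⟨0, hk⟩ 1, single_mem_stdSimplex ℝ _⟩ with hg
  refine ⟨Finset.univ.image g, ⟨g 0, Finset.mem_image_of_mem _ (Finset.mem_univ _)⟩, ?_, ?_⟩
  · refine Finset.card_image_le.trans ?_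
    simp
  intro w
  have w0 : ∀ i, 0 ≤ w.1 i := w.2.1
  have w1 : ∑ i, w.1 i = 1 := w.2.2
  -- A coordinate of at least average weight absorbs what rounding down leaves over. Charging it is
  -- allowed because `1 / G ≤ 1 / k`; any other charged coordinate has a nonzero floor.
  obtain ⟨i₀, hi₀⟩ : ∃ i, 1 / (k : ℝ) ≤ w.1 i := by
    by_contra! h
    have := Finset.sum_lt_sum_of_nonempty (s := (Finset.univ : Finset (Fin k)))
      Finset.univ_nonempty (fun i _ => h i)
    rw [w1] at this
    have hk' : (k : ℝ) ≠ 0 := by exact_mod_cast hk.ne'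
    simp [hk'] at this
  set a : Fin k → ℕ := fun i => ⌊G * w.1 i⌋₊ with ha
  have ha1 : ∀ i, (a i : ℝ) ≤ G * w.1 i := fun i =>
    Nat.floor_le (mul_nonneg hG0.le (w0 i))
  have ha2 : ∀ i, G * w.1 i < a i + 1 := fun i => Nat.lt_floor_add_one _
  have hsum : ((∑ i, a i : ℕ) : ℝ) ≤ G := by
    push_cast
    calc ∑ i, (a i : ℝ) ≤ ∑ i, G * w.1 i := Finset.sum_le_sum fun i _ => ha1 i
      _ = G := by rw [← Finset.mul_sum, w1, mul_one]
  have hsum' : ∑ i, a i ≤ G := by exact_mod_cast hsum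
  set rem : ℕ := G - ∑ i, a i with hrem
  have hremle : (rem : ℝ) ≤ k := by
    rw [hrem, Nat.cast_sub hsum']
    push_cast
    have : ∑ i, G * w.1 i ≤ ∑ i, ((a i : ℝ) + 1) := Finset.sum_le_sum fun i _ => (ha2 i).le
    rw [← Finset.mul_sum, w1, mul_one, Finset.sum_add_distrib] at this
    simp at this
    linarith
  set b : Fin k → ℕ := fun i => a i + if i = i₀ then rem else 0 with hb
  have hbsum : ∑ i, b i = G := by
    simp only [hb, Finset.sum_add_distrib, Finset.sum_ite_eq', Finset.mem_univ, if_true]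
    omega
  have hble : ∀ i, b i < G + 1 := fun i => by
    have := Finset.single_le_sum (f := b) (fun i _ => Nat.zero_le _) (Finset.mem_univ i)
    omega
  refine ⟨g fun i => ⟨b i, hble i⟩, Finset.mem_image_of_mem _ (Finset.mem_univ _), ?_⟩
  have hval : ∀ i, (g fun i => ⟨b i, hble i⟩).1 i = (b i : ℝ) / G := by
    intro i
    have : ∑ i, ((b i : ℕ) : ℝ) = G := by exact_mod_cast hbsum
    simp only [hg, dif_pos this]
  simp only [hval]
  constructor
  · have hbound : ∀ i, |w.1 i - (b i : ℝ) / G| ≤ 1 / G + (if i = i₀ then (rem : ℝ) else 0) / G := by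
      intro i
      have e : w.1 i - (b i : ℝ) / G =
          (G * w.1 i - a i) / G - (if i = i₀ then (rem : ℝ) else 0) / G := by
        simp only [hb]; push_cast; field_simp; ring
      rw [e]
      refine (abs_sub _ _).trans (add_le_add ?_ ?_)
      · rw [abs_div, abs_of_pos hG0]
        gcongr
        rw [abs_le]; constructor <;> linarith [ha1 i, ha2 i]
      · rw [abs_of_nonneg (by positivity)]
    refine (Finset.sum_le_sum fun i _ => hbound i).trans ?_
    rw [Finset.sum_add_distrib, ← Finset.sum_div, ← Finset.sum_div, ← add_div]
    simp only [Finset.sum_const, Finset.card_univ, Fintype.card_fin, nsmul_eq_mul,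
      Finset.sum_ite_eq', Finset.mem_univ, if_true]
    gcongr
    linarith
  · intro i hi
    have hb0 : 0 < b i := by
      rcases Nat.eq_zero_or_pos (b i) with h | h
      · simp [h] at hi
      · exact h
    by_cases h : i = i₀
    · subst h
      refine le_trans ?_ hi₀
      gcongr
    · have : 1 ≤ a i := by simp [hb, h] at hb0; omega
      rw [div_le_iff₀ hG0]
      have : (1 : ℝ) ≤ a i := by exact_mod_cast this
      linarith [ha1 i, mul_comm (G : ℝ) (w.1 i)]

end Grid

/-! ### Product measures: marginals, blocks, mixtures, resampling -/

section ProductMeasures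

variable {X : Type*} [MeasurableSpace X]

/-- A box pulls back to a box whose sides outside the range of `e` are the whole space and
contribute the factor one. -/
theorem pi_map_comp_injective {ι ι' : Type*} [Fintype ι] [Fintype ι'] (μ : ι → Measure X)
    [∀ i, IsProbabilityMeasure (μ i)] {e : ι' → ι} (he : Function.Injective e) :
    (Measure.pi μ).map (fun x j => x (e j)) = Measure.pi fun j => μ (e j) := by
  classical
  refine (Measure.pi_eq fun s hs => ?_).symm
  have hm : Measurable fun (x : ι → X) (j : ι') => x (e j) := by fun_prop
  rw [Measure.map_apply hm (MeasurableSet.univ_pi hs)]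
  have : (fun (x : ι → X) (j : ι') => x (e j)) ⁻¹' (Set.univ.pi s) =
      Set.univ.pi (Function.extend e s fun _ => Set.univ) := by
    ext x
    simp only [Set.mem_preimage, Set.mem_univ_pi]
    constructor
    · intro h i
      by_cases hi : ∃ j, e j = i
      · obtain ⟨j, rfl⟩ := hi
        rw [he.extend_apply]; exact h j
      · rw [Function.extend_apply' _ _ _ hi]; trivial
    · intro h j
      have := h (e j)
      rwa [he.extend_apply] at this
  rw [this, Measure.pi_pi]
  refine (Fintype.prod_of_injective e he _ _ (fun i hi => ?_) fun j => ?_).symm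
  · rw [Function.extend_apply' _ _ _ (by simpa using hi), measure_univ]
  · rw [he.extend_apply]

theorem measurePreserving_comp_injective {ι ι' : Type*} [Fintype ι] [Fintype ι']
    (μ : ι → Measure X) [∀ i, IsProbabilityMeasure (μ i)] {e : ι' → ι}
    (he : Function.Injective e) :
    MeasurePreserving (fun (x : ι → X) j => x (e j)) (Measure.pi μ)
      (Measure.pi fun j => μ (e j)) :=
  ⟨by fun_prop, pi_map_comp_injective μ he⟩

theorem measurePreserving_uncurry {ι κ : Type*} [Fintype ι] [Fintype κ]
    (μ : ι → κ → Measure X) [∀ i j, IsProbabilityMeasure (μ i j)] :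
    MeasurePreserving (fun (x : ι → κ → X) (p : ι × κ) => x p.1 p.2)
      (Measure.pi fun i => Measure.pi (μ i)) (Measure.pi fun p : ι × κ => μ p.1 p.2) := by
  have hm : Measurable fun (x : ι → κ → X) (p : ι × κ) => x p.1 p.2 := by fun_prop
  refine ⟨hm, (Measure.pi_eq fun s hs => ?_).symm⟩
  rw [Measure.map_apply hm (MeasurableSet.univ_pi hs)]
  have : (fun (x : ι → κ → X) (p : ι × κ) => x p.1 p.2) ⁻¹' (Set.univ.pi s) =
      Set.univ.pi fun i => Set.univ.pi fun j => s (i, j) := by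
    ext x; simp [Set.mem_pi]
  rw [this, Measure.pi_pi, Fintype.prod_prod_type]
  simp_rw [Measure.pi_pi]

/-- Functions of the blocks of a product space are independent. -/
theorem lintegral_prod_blocks {ι κ : Type*} [Fintype ι] [Fintype κ]
    (μ : Measure X) [IsProbabilityMeasure μ] {g : (κ → X) → ℝ≥0∞} (hg : Measurable g) :
    ∫⁻ x : ι × κ → X, ∏ i, g (fun j => x (i, j)) ∂(Measure.pi fun _ => μ) =
      ∏ _i : ι, ∫⁻ y, g y ∂(Measure.pi fun _ => μ) := by
  have h := measurePreserving_uncurry (ι := ι) (κ := κ) (fun _ _ => μ)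
  have hgm : ∀ i, Measurable fun x : ι × κ → X => g fun j => x (i, j) :=
    fun i => hg.comp (by fun_prop)
  rw [← h.lintegral_comp (Finset.measurable_prod _ fun i _ => hgm i)]
  have hind : iIndepFun (fun (i : ι) (x : ι → κ → X) => g (x i))
      (Measure.pi fun _ : ι => Measure.pi fun _ : κ => μ) :=
    iIndepFun_pi fun i => hg.aemeasurable
  have := lintegral_prod_eq_prod_lintegral_of_indepFun Finset.univ _ hind
    (fun i => hg.comp (measurable_pi_apply i))
  rw [this]
  refine Finset.prod_congr rfl fun i _ => ?_
  exact (measurePreserving_eval (fun _ : ι => Measure.pi fun _ : κ => μ) i).lintegral_comp hg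

/-- A product of mixtures is the mixture, over all labellings of the coordinates, of products. -/
theorem pi_sum_smul {ι I : Type*} [Fintype ι] [Fintype I] [DecidableEq ι] (w : I → ℝ≥0∞)
    (hw : ∑ i, w i = 1) (P : I → Measure X) [∀ i, IsProbabilityMeasure (P i)] :
    Measure.pi (fun _ : ι => ∑ i, w i • P i) =
      ∑ l : ι → I, (∏ j, w (l j)) • Measure.pi fun j => P (l j) := by
  have : IsProbabilityMeasure (∑ i, w i • P i) := ⟨by simp [hw]⟩
  refine Measure.pi_eq fun s hs => ?_
  simp only [Measure.coe_finsetSum, Finset.sum_apply, Measure.smul_apply, smul_eq_mul,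
    Measure.pi_pi]
  rw [Finset.prod_univ_sum]
  simp only [Fintype.piFinset_univ, Finset.prod_mul_distrib]

/-- Resampling one coordinate of a product measure. -/
theorem pi_prod_map_update {ι : Type*} [Fintype ι] [DecidableEq ι] (μ : ι → Measure X)
    [∀ i, IsProbabilityMeasure (μ i)] (j : ι) (ν : Measure X) [IsProbabilityMeasure ν] :
    ((Measure.pi μ).prod ν).map (fun p => Function.update p.1 j p.2) =
      Measure.pi (Function.update μ j ν) := by
  have : ∀ i, IsProbabilityMeasure (Function.update μ j ν i) := fun i => by
    by_cases h : i = j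
    · subst h; rw [Function.update_self]; infer_instance
    · rw [Function.update_of_ne h]; infer_instance
  have hm : Measurable fun p : (ι → X) × X => Function.update p.1 j p.2 := by
    refine measurable_pi_lambda _ fun i => ?_
    by_cases h : i = j
    · subst h; simp only [Function.update_self]; exact measurable_snd
    · simp only [Function.update_of_ne h]; fun_prop
  refine (Measure.pi_eq fun s hs => ?_).symm
  rw [Measure.map_apply hm (MeasurableSet.univ_pi hs)]
  have : (fun p : (ι → X) × X => Function.update p.1 j p.2) ⁻¹' (Set.univ.pi s) =
      (Set.univ.pi (Function.update s j Set.univ)) ×ˢ (s j) := by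
    ext p
    simp only [Set.mem_preimage, Set.mem_univ_pi, Set.mem_prod]
    constructor
    · intro h
      refine ⟨fun i => ?_, by simpa using h j⟩
      by_cases hi : i = j
      · subst hi; simp
      · have := h i
        simpa [Function.update_of_ne hi] using this
    · rintro ⟨h, h'⟩ i
      by_cases hi : i = j
      · subst hi; simpa using h'
      · have := h i
        simpa [Function.update_of_ne hi] using this
  rw [this, Measure.prod_prod, Measure.pi_pi, Fintype.prod_eq_mul_prod_compl j,
    Fintype.prod_eq_mul_prod_compl j]
  simp only [Function.update_self, measure_univ, one_mul]
  rw [mul_comm]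
  congr 1
  refine Finset.prod_congr rfl fun i hi => ?_
  have : i ≠ j := by simpa using hi
  rw [Function.update_of_ne this, Function.update_of_ne this]

end ProductMeasures

/-! ### Independent runs of kernels -/

section ProductKernel

variable {α Y : Type*} [MeasurableSpace α] [MeasurableSpace Y] {I : Type*} [Fintype I]

/-- The kernel that runs finitely many kernels on the same input independently. -/
def piKernel (K : I → Kernel α Y) [∀ i, IsMarkovKernel (K i)] : Kernel α (I → Y) where
  toFun x := Measure.pi fun i => K i x
  measurable' := by
    refine Measurable.measure_of_isPiSystem_of_isProbabilityMeasure generateFrom_pi.symm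
      isPiSystem_pi ?_
    rintro _ ⟨s, hs, rfl⟩
    simp only [Measure.pi_pi]
    exact Finset.measurable_prod _ fun i _ => (K i).measurable_coe (hs i (Set.mem_univ i))

theorem piKernel_apply (K : I → Kernel α Y) [∀ i, IsMarkovKernel (K i)] (x : α) :
    piKernel K x = Measure.pi fun i => K i x := rfl

instance isMarkovKernel_piKernel (K : I → Kernel α Y) [∀ i, IsMarkovKernel (K i)] :
    IsMarkovKernel (piKernel K) :=
  ⟨fun x => by rw [piKernel_apply]; infer_instance⟩

end ProductKernel

/-! ### Concentration of empirical frequencies -/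

section Hoeffding

variable {X : Type*} [MeasurableSpace X]

/-- The empirical frequency of a set in a sample. -/
def empFreq {s : ℕ} (A : Set X) (z : Fin s → X) : ℝ :=
  (∑ j, A.indicator (fun _ => (1 : ℝ)) (z j)) / s

theorem measurable_empFreq {s : ℕ} {A : Set X} (hA : MeasurableSet A) :
    Measurable (empFreq A : (Fin s → X) → ℝ) := by
  unfold empFreq
  refine Measurable.div_const (Finset.measurable_sum _ fun j _ => ?_) _
  exact (measurable_const.indicator hA).comp (measurable_pi_apply j)

/-- Hoeffding's lemma makes each summand sub-Gaussian with proxy `1 / 4`. Only the length of the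
interval is fixed, so the bound serves both an indicator and its negative. -/
theorem measure_sum_sub_ge_le (P : Measure X) [IsProbabilityMeasure P] {s : ℕ} {f : X → ℝ}
    (hf : Measurable f) {a b : ℝ} (hab : b - a = 1) (h01 : ∀ x, f x ∈ Set.Icc a b)
    {η : ℝ} (hη : 0 ≤ η) :
    (Measure.pi fun _ : Fin s => P).real {z | s * η ≤ ∑ j, (f (z j) - ∫ x, f x ∂P)} ≤
      Real.exp (-2 * s * η ^ 2) := by
  have hind : iIndepFun (fun (j : Fin s) (z : Fin s → X) => f (z j) - ∫ x, f x ∂P)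
      (Measure.pi fun _ : Fin s => P) :=
    iIndepFun_pi (X := fun (_ : Fin s) x => f x - ∫ x, f x ∂P)
      fun i => (hf.sub_const _).aemeasurable
  have hsub : ∀ j ∈ (Finset.univ : Finset (Fin s)),
      HasSubgaussianMGF (fun z : Fin s → X => f (z j) - ∫ x, f x ∂P) ((‖b - a‖₊ / 2) ^ 2)
        (Measure.pi fun _ : Fin s => P) := by
    intro j _
    have h := hasSubgaussianMGF_of_mem_Icc (μ := Measure.pi fun _ : Fin s => P)
      (X := fun z : Fin s → X => f (z j)) (a := a) (b := b)
      (hf.comp (measurable_pi_apply j)).aemeasurable (ae_of_all _ fun z => h01 (z j))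
    have e : ∫ z : Fin s → X, f (z j) ∂(Measure.pi fun _ : Fin s => P) = ∫ x, f x ∂P := by
      have := integral_map (μ := Measure.pi fun _ : Fin s => P)
        (measurable_pi_apply j).aemeasurable (f := f) hf.aestronglyMeasurable
      rw [(measurePreserving_eval (fun _ : Fin s => P) j).map_eq] at this
      exact this.symm
    rwa [e] at h
  have := HasSubgaussianMGF.measure_sum_ge_le_of_iIndepFun hind hsub
    (ε := s * η) (by positivity)
  refine this.trans (Real.exp_le_exp.2 ?_)
  rw [hab]
  simp only [Finset.sum_const, Finset.card_univ, Fintype.card_fin, nsmul_eq_mul]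
  rcases Nat.eq_zero_or_pos s with h | h
  · subst h; simp
  · have : (0 : ℝ) < s := by exact_mod_cast h
    simp
    apply le_of_eq
    field_simp

/-- **Hoeffding's inequality** for empirical frequencies. -/
theorem measure_empFreq_le (P : ProbabilityMeasure X) {s : ℕ} (hs : 0 < s) {A : Set X}
    (hA : MeasurableSet A) {η : ℝ} (hη : 0 ≤ η) :
    (Measure.pi fun _ : Fin s => (P : Measure X))
      {z | η < |(P : Measure X).real A - empFreq A z|} ≤
        ENNReal.ofReal (2 * Real.exp (-2 * s * η ^ 2)) := by
  have hs' : (0 : ℝ) < s := by exact_mod_cast hs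
  set f : X → ℝ := A.indicator fun _ => 1 with hf
  have hfm : Measurable f := measurable_const.indicator hA
  have hint : ∫ x, f x ∂(P : Measure X) = (P : Measure X).real A := by
    rw [hf, integral_indicator hA]; simp
  have h1 := measure_sum_sub_ge_le (P : Measure X) (s := s) hfm (a := 0) (b := 1) (by norm_num)
    (fun x => by
      rw [hf]; by_cases h : x ∈ A <;> simp [h]) hη
  have h2 := measure_sum_sub_ge_le (P : Measure X) (s := s) hfm.neg (a := -1) (b := 0)
    (by norm_num) (fun x => by
      rw [hf]; by_cases h : x ∈ A <;> simp [h]) hη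
  simp only [Pi.neg_apply, integral_neg, hint] at h1 h2
  have hsub : {z : Fin s → X | η < |(P : Measure X).real A - empFreq A z|} ⊆
      {z | s * η ≤ ∑ j, (f (z j) - (P : Measure X).real A)} ∪
        {z | s * η ≤ ∑ j, (-f (z j) - -(P : Measure X).real A)} := by
    intro z hz
    have e : ∑ j, f (z j) = s * empFreq A z := by
      rw [empFreq, mul_div_cancel₀ _ hs'.ne']
    simp only [Set.mem_union, Set.mem_ofPred_eq, Finset.sum_sub_distrib, Finset.sum_neg_distrib, e,
      Finset.sum_const, Finset.card_univ, Fintype.card_fin, nsmul_eq_mul]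
    simp only [Set.mem_ofPred_eq] at hz
    rcases lt_abs.1 hz with h | h
    · right; nlinarith
    · left; nlinarith
  refine (measure_mono hsub).trans ((measure_union_le _ _).trans ?_)
  rw [two_mul, ENNReal.ofReal_add (Real.exp_pos _).le (Real.exp_pos _).le]
  refine add_le_add ?_ ?_
  · rw [← ofReal_measureReal]; exact ENNReal.ofReal_le_ofReal h1
  · rw [← ofReal_measureReal]; exact ENNReal.ofReal_le_ofReal h2

end Hoeffding

/-! ### Amplifying the list decoder on the components of a mixture -/

section Boosting

variable {X Y : Type*} [MeasurableSpace X] [MeasurableSpace Y] {m : ℕ}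

/-- Run an algorithm with `m` samples independently on all `m`-tuples of entries of a data set of
size `s`. -/
def allTuplesKernel (A : Kernel (Fin m → X) Y) [IsMarkovKernel A] (s : ℕ) :
    Kernel (Fin s → X) ((Fin m → Fin s) → Y) :=
  piKernel fun σ : Fin m → Fin s =>
    A.comap (fun (x : Fin s → X) (j : Fin m) => x (σ j)) (by fun_prop)

instance isMarkovKernel_allTuplesKernel (A : Kernel (Fin m → X) Y) [IsMarkovKernel A] (s : ℕ) :
    IsMarkovKernel (allTuplesKernel A s) := by
  unfold allTuplesKernel; infer_instance

/-- For fixed data the runs on distinct tuples are independent, even if the tuples share entries.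
Keeping only the tuples listed by `E` enlarges the failure event. -/
theorem allTuplesKernel_le_prod (A : Kernel (Fin m → X) Y) [IsMarkovKernel A] {s r : ℕ}
    {bad : Set Y} (hbad : MeasurableSet bad) {E : Fin r → Fin m → Fin s}
    (hE : Function.Injective E) (x : Fin s → X) :
    allTuplesKernel A s x {y | ∀ σ, y σ ∈ bad} ≤ ∏ a, A (fun b => x (E a b)) bad := by
  unfold allTuplesKernel
  rw [piKernel_apply]
  have h := pi_map_comp_injective (fun σ : Fin m → Fin s =>
    A.comap (fun (x : Fin s → X) (j : Fin m) => x (σ j)) (by fun_prop) x) hE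
  have hm : MeasurableSet (Set.univ.pi fun _ : Fin r => bad) := MeasurableSet.univ_pi fun _ => hbad
  have h2 := congrArg (fun μ => μ (Set.univ.pi fun _ : Fin r => bad)) h
  simp only [Measure.pi_pi, Kernel.comap_apply] at h2
  rw [← h2, Measure.map_apply (by fun_prop) hm]
  exact measure_mono fun y hy => by
    simp only [Set.mem_preimage, Set.mem_univ_pi]; exact fun a => hy _

theorem measurableSet_forall_mem {bad : Set Y} (hbad : MeasurableSet bad) {I : Type*}
    [Countable I] : MeasurableSet {y : I → Y | ∀ i, y i ∈ bad} := by
  have : {y : I → Y | ∀ i, y i ∈ bad} = ⋂ i, (fun y => y i) ⁻¹' bad := by ext; simp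
  rw [this]
  exact MeasurableSet.iInter fun i => (measurable_pi_apply i) hbad

/-- If many entries of the data set are drawn from `P i`, then all runs fail only if the runs on
many disjoint tuples of entries drawn from `P i` fail. -/
theorem lintegral_allTuplesKernel_le {I : Type*} [DecidableEq I] (A : Kernel (Fin m → X) Y)
    [IsMarkovKernel A] (hm : 0 < m) {s r : ℕ} {bad : Set Y} (hbad : MeasurableSet bad)
    (P : I → Measure X) [∀ i, IsProbabilityMeasure (P i)] (i : I) (l : Fin s → I)
    (hl : r * m ≤ (Finset.univ.filter fun j => l j = i).card) :
    ∫⁻ x, allTuplesKernel A s x {y | ∀ σ, y σ ∈ bad} ∂(Measure.pi fun j => P (l j)) ≤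
      ((A ∘ₘ Measure.pi fun _ : Fin m => P i) bad) ^ r := by
  -- The rows of an `r × m` array placed among the coordinates with label `i` are the disjoint
  -- tuples.
  obtain ⟨e⟩ : Nonempty (Fin r × Fin m ↪ {j // l j = i}) := by
    apply Function.Embedding.nonempty_of_card_le
    rw [Fintype.card_prod, Fintype.card_fin, Fintype.card_fin, Fintype.card_subtype]
    exact hl
  have he : Function.Injective fun p : Fin r × Fin m => (e p).1 :=
    Subtype.val_injective.comp e.injective
  have hE : Function.Injective fun (a : Fin r) (b : Fin m) => (e (a, b)).1 := by
    intro a a' h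
    -- Disjoint rows differ as tuples because they have a first entry; for `m = 0` all rows would
    -- coincide.
    have := congrFun h ⟨0, hm⟩
    exact congrArg Prod.fst (he this)
  set g : (Fin m → X) → ℝ≥0∞ := fun y => A y bad with hg
  have hgm : Measurable g := A.measurable_coe hbad
  calc ∫⁻ x, allTuplesKernel A s x {y | ∀ σ, y σ ∈ bad} ∂(Measure.pi fun j => P (l j))
      ≤ ∫⁻ x, ∏ a, g (fun b => x (e (a, b)).1) ∂(Measure.pi fun j => P (l j)) :=
        lintegral_mono fun x => allTuplesKernel_le_prod A hbad hE x
    _ = ∫⁻ x : Fin r × Fin m → X, ∏ a, g (fun b => x (a, b))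
          ∂(Measure.pi fun p : Fin r × Fin m => P (l (e p).1)) := by
        refine (measurePreserving_comp_injective (fun j => P (l j)) he).lintegral_comp
          (f := fun x : Fin r × Fin m → X => ∏ a, g (fun b => x (a, b))) ?_
        exact Finset.measurable_prod _ fun a _ => hgm.comp (by fun_prop)
    _ = ((A ∘ₘ Measure.pi fun _ : Fin m => P i) bad) ^ r := by
        have : ∀ p, l (e p).1 = i := fun p => (e p).2
        simp only [this]
        rw [lintegral_prod_blocks (P i) hgm, Finset.prod_const, Finset.card_univ,
          Fintype.card_fin, Measure.bind_apply hbad A.aemeasurable]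

/-- This is the Laplace transform at `-1` of a binomial count: it factors over the samples as `(1 -
v i * (1 - exp (-1))) ^ s`, and `exp (-1) ≤ 1 / 2`. -/
theorem sum_prod_mul_exp_neg_count_le {I : Type*} [Fintype I] [DecidableEq I] (v : I → ℝ)
    (hv0 : ∀ i, 0 ≤ v i) (hv1 : ∑ i, v i = 1) (i : I) (s : ℕ) :
    ∑ l : Fin s → I, (∏ j, v (l j)) *
      Real.exp (-((Finset.univ.filter fun j => l j = i).card : ℝ)) ≤
        Real.exp (-(v i * s / 2)) := by
  have h1 : ∀ l : Fin s → I, (∏ j, v (l j)) *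
      Real.exp (-((Finset.univ.filter fun j => l j = i).card : ℝ)) =
      ∏ j, (v (l j) * if l j = i then Real.exp (-1) else 1) := by
    intro l
    rw [Finset.prod_mul_distrib, Finset.prod_ite]
    simp only [Finset.prod_const, one_pow, mul_one]
    rw [← Real.exp_nat_mul]
    simp
  simp only [h1]
  have h2 := Finset.prod_univ_sum (fun _ : Fin s => (Finset.univ : Finset I))
    (fun _ a => v a * if a = i then Real.exp (-1) else 1)
  rw [Fintype.piFinset_univ] at h2
  rw [← h2, Finset.prod_const, Finset.card_univ, Fintype.card_fin]
  have h3 : ∑ a, (v a * if a = i then Real.exp (-1) else 1) = 1 - v i * (1 - Real.exp (-1)) := by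
    have : ∀ a, (v a * if a = i then Real.exp (-1) else 1) =
        v a - if a = i then v a * (1 - Real.exp (-1)) else 0 := by
      intro a; split_ifs <;> ring
    simp only [this, Finset.sum_sub_distrib, hv1, Finset.sum_ite_eq', Finset.mem_univ, if_true]
  have h4 : Real.exp (-1) ≤ 1 / 2 := by
    rw [Real.exp_neg, ← one_div]
    apply one_div_le_one_div_of_le (by norm_num)
    linarith [Real.add_one_le_exp (1 : ℝ)]
  have h5 : (1 : ℝ) - v i * (1 - Real.exp (-1)) ≤ Real.exp (-(v i / 2)) := by
    refine le_trans ?_ (Real.add_one_le_exp _)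
    nlinarith [hv0 i]
  have h6 : 0 ≤ (1 : ℝ) - v i * (1 - Real.exp (-1)) := by
    rw [← h3]
    refine Finset.sum_nonneg fun a _ => mul_nonneg (hv0 a) ?_
    split_ifs <;> positivity
  rw [h3]
  refine (pow_le_pow_left₀ h6 h5 s).trans (le_of_eq ?_)
  rw [← Real.exp_nat_mul]
  congr 1; ring

/-- On samples of a mixture, running an algorithm on all tuples of samples amplifies its success
probability on each component of the mixture. -/
theorem allTuplesKernel_mixture_le {I : Type*} [Fintype I] [DecidableEq I]
    (A : Kernel (Fin m → X) Y) [IsMarkovKernel A] (hm : 0 < m) (s r : ℕ) {bad : Set Y}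
    (hbad : MeasurableSet bad) (P : I → Measure X) [∀ i, IsProbabilityMeasure (P i)] (v : I → ℝ)
    (hv0 : ∀ i, 0 ≤ v i) (hv1 : ∑ i, v i = 1) (i : I) {b : ℝ≥0∞}
    (hb : (A ∘ₘ Measure.pi fun _ : Fin m => P i) bad ≤ b) :
    (allTuplesKernel A s ∘ₘ Measure.pi fun _ : Fin s => ∑ i, ENNReal.ofReal (v i) • P i)
      {y | ∀ σ, y σ ∈ bad} ≤ ENNReal.ofReal (Real.exp (r * m - v i * s / 2)) + b ^ r := by
  have hw : ∑ i, ENNReal.ofReal (v i) = 1 := by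
    rw [← ENNReal.ofReal_sum_of_nonneg fun i _ => hv0 i, hv1, ENNReal.ofReal_one]
  rw [Measure.bind_apply (measurableSet_forall_mem hbad) (Kernel.aemeasurable _),
    pi_sum_smul _ hw, lintegral_finsetSum_measure]
  simp only [lintegral_smul_measure, smul_eq_mul]
  set c : (Fin s → I) → ℕ := fun l => (Finset.univ.filter fun j => l j = i).card with hc
  -- Chernoff's bound in pointwise form: for a labelling with too few entries `i`, the exponential
  -- exceeds one and the bound is trivial; otherwise there are enough entries for `r` disjoint
  -- tuples.
  have hQ : ∀ l : Fin s → I,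
      ∫⁻ x, allTuplesKernel A s x {y | ∀ σ, y σ ∈ bad} ∂(Measure.pi fun j => P (l j)) ≤
        ENNReal.ofReal (Real.exp (r * m - c l)) + b ^ r := by
    intro l
    rcases lt_or_ge (c l) (r * m) with h | h
    · refine le_add_right ?_
      have h1 : (1 : ℝ) ≤ Real.exp (r * m - c l) := by
        rw [Real.one_le_exp_iff]
        have : (c l : ℝ) ≤ r * m := by exact_mod_cast h.le
        linarith
      calc ∫⁻ x, allTuplesKernel A s x {y | ∀ σ, y σ ∈ bad} ∂(Measure.pi fun j => P (l j))
          ≤ ∫⁻ _, 1 ∂(Measure.pi fun j => P (l j)) := lintegral_mono fun x => prob_le_one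
        _ = ENNReal.ofReal 1 := by simp
        _ ≤ _ := ENNReal.ofReal_le_ofReal h1
    · refine le_add_left ((lintegral_allTuplesKernel_le A hm hbad P i l h).trans ?_)
      gcongr
  calc ∑ l : Fin s → I, (∏ j, ENNReal.ofReal (v (l j))) *
        ∫⁻ x, allTuplesKernel A s x {y | ∀ σ, y σ ∈ bad} ∂(Measure.pi fun j => P (l j))
      ≤ ∑ l : Fin s → I, (∏ j, ENNReal.ofReal (v (l j))) *
          (ENNReal.ofReal (Real.exp (r * m - c l)) + b ^ r) :=
        Finset.sum_le_sum fun l _ => by gcongr; exact hQ l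
    _ = ∑ l : Fin s → I, ENNReal.ofReal ((∏ j, v (l j)) * Real.exp (r * m - c l)) + b ^ r := by
        simp only [mul_add, Finset.sum_add_distrib]
        congr 1
        · refine Finset.sum_congr rfl fun l _ => ?_
          rw [ENNReal.ofReal_mul (Finset.prod_nonneg fun j _ => hv0 _),
            ENNReal.ofReal_prod_of_nonneg fun j _ => hv0 _]
        · rw [← Finset.sum_mul]
          have := Finset.prod_univ_sum (fun _ : Fin s => (Finset.univ : Finset I))
            (fun _ a => ENNReal.ofReal (v a))
          rw [Fintype.piFinset_univ] at this
          rw [← this, hw]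
          simp
    _ ≤ _ := by
        gcongr
        rw [← ENNReal.ofReal_sum_of_nonneg fun l _ =>
          mul_nonneg (Finset.prod_nonneg fun j _ => hv0 _) (Real.exp_pos _).le]
        refine ENNReal.ofReal_le_ofReal ?_
        have h := sum_prod_mul_exp_neg_count_le v hv0 hv1 i s
        calc ∑ l : Fin s → I, (∏ j, v (l j)) * Real.exp (r * m - c l)
            = Real.exp (r * m) * ∑ l : Fin s → I, (∏ j, v (l j)) * Real.exp (-(c l : ℝ)) := by
              rw [Finset.mul_sum]
              refine Finset.sum_congr rfl fun l _ => ?_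
              rw [sub_eq_add_neg, Real.exp_add]; ring
          _ ≤ Real.exp (r * m) * Real.exp (-(v i * s / 2)) := by gcongr
          _ = _ := by rw [← Real.exp_add, ← sub_eq_add_neg]

end Boosting

/-! ### The private selection mechanism -/

section Selection

variable {J H O : Type*} [Fintype J] [DecidableEq H]

/-- The unnormalized weight of a candidate that belongs to some of the sets `S j`. -/
def selWeight (η : ℝ) (S : J → Finset H) (h : H) : ℝ :=
  Real.exp (η * (Finset.univ.filter fun j => h ∈ S j).card) - 1

theorem selWeight_nonneg {η : ℝ} (hη : 0 ≤ η) (S : J → Finset H) (h : H) :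
    0 ≤ selWeight η S h := by
  rw [selWeight, sub_nonneg, Real.one_le_exp_iff]
  positivity

/-- This is the purpose of the `- 1` in the weight: candidates found nowhere have no mass, so an
infinite `H` causes no trouble. -/
theorem selWeight_eq_zero {η : ℝ} {S : J → Finset H} {h : H} (hh : h ∉ Finset.univ.biUnion S) :
    selWeight η S h = 0 := by
  have : (Finset.univ.filter fun j => h ∈ S j) = ∅ := by
    rw [Finset.filter_eq_empty_iff]
    intro j _ hj
    exact hh (Finset.mem_biUnion.2 ⟨j, Finset.mem_univ j, hj⟩)
  simp [selWeight, this]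

open scoped Classical in
/-- The total weight of the candidates in the sets `S j` whose outcome lies in `E`. -/
def selMass (η : ℝ) (φ : H → O) (S : J → Finset H) (E : Set O) : ℝ :=
  ∑ h ∈ (Finset.univ.biUnion S).filter fun h => φ h ∈ E, selWeight η S h

theorem selMass_nonneg {η : ℝ} (hη : 0 ≤ η) (φ : H → O) (S : J → Finset H) (E : Set O) :
    0 ≤ selMass η φ S E :=
  Finset.sum_nonneg fun h _ => selWeight_nonneg hη S h

/-- The selection mechanism: it outputs a candidate with probability proportional to its weight,
and the default value `o` with weight `W`. -/
def selMeasure [MeasurableSpace O] (η W : ℝ) (φ : H → O) (o : O) (S : J → Finset H) : Measure O :=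
  ∑ h ∈ Finset.univ.biUnion S,
    ENNReal.ofReal (selWeight η S h / (selMass η φ S Set.univ + W)) • Measure.dirac (φ h)
  + ENNReal.ofReal (W / (selMass η φ S Set.univ + W)) • Measure.dirac o

theorem selMeasure_apply [MeasurableSpace O] {η W : ℝ} (hη : 0 ≤ η) (hW : 0 < W) (φ : H → O) (o : O)
    (S : J → Finset H) {E : Set O} (hE : MeasurableSet E) :
    selMeasure η W φ o S E = ENNReal.ofReal
      ((selMass η φ S E + E.indicator (fun _ => W) o) / (selMass η φ S Set.univ + W)) := by
  classical
  have hZ := selMass_nonneg hη φ S Set.univ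
  have hZ' : 0 < selMass η φ S Set.univ + W := by linarith
  simp only [selMeasure, Measure.coe_add, Pi.add_apply, Measure.coe_finsetSum, Finset.sum_apply,
    Measure.smul_apply, smul_eq_mul, Measure.dirac_apply' _ hE]
  rw [add_div, ENNReal.ofReal_add (div_nonneg (selMass_nonneg hη φ S E) hZ'.le)
    (div_nonneg (Set.indicator_nonneg (fun _ _ => hW.le) _) hZ'.le)]
  congr 1
  · generalize selMass η φ S Set.univ + W = Z at hZ'
    rw [selMass, Finset.sum_div, ENNReal.ofReal_sum_of_nonneg fun h _ =>
      div_nonneg (selWeight_nonneg hη S h) hZ'.le, Finset.sum_filter]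
    refine Finset.sum_congr rfl fun h _ => ?_
    by_cases hh : φ h ∈ E <;> simp [hh]
  · by_cases hh : o ∈ E <;> simp [hh]

theorem isProbabilityMeasure_selMeasure [MeasurableSpace O] {η W : ℝ} (hη : 0 ≤ η) (hW : 0 < W)
    (φ : H → O) (o : O) (S : J → Finset H) : IsProbabilityMeasure (selMeasure η W φ o S) := by
  have hZ := selMass_nonneg hη φ S Set.univ
  constructor
  rw [selMeasure_apply hη hW φ o S MeasurableSet.univ, Set.indicator_of_mem (Set.mem_univ o),
    div_self (by linarith : selMass η φ S Set.univ + W ≠ 0), ENNReal.ofReal_one]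

/-- The count grows by at most one, and `exp (η (n + 1)) - 1 = exp η * (exp (η n) - 1) + (exp η -
1)`. The additive term occurs only for members of the new set. -/
theorem selWeight_le_of_eq_off [DecidableEq J] {η : ℝ} (hη : 0 ≤ η) {S S' : J → Finset H} {j : J}
    (hS : ∀ i, i ≠ j → S i = S' i) (h : H) :
    selWeight η S' h ≤ Real.exp η * selWeight η S h +
      if h ∈ S' j then Real.exp η - 1 else 0 := by
  have he : 1 ≤ Real.exp η := Real.one_le_exp hη
  split_ifs with hj
  · have hc : (Finset.univ.filter fun i => h ∈ S' i).card ≤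
        (Finset.univ.filter fun i => h ∈ S i).card + 1 := by
      refine (Finset.card_le_card (t := insert j (Finset.univ.filter fun i => h ∈ S i)) ?_).trans
        (Finset.card_insert_le _ _)
      intro i hi
      by_cases hij : i = j
      · simp [hij]
      · have := hS i hij
        simp only [Finset.mem_filter, Finset.mem_univ, true_and, Finset.mem_insert] at hi ⊢
        exact Or.inr (this ▸ hi)
    have : selWeight η S' h ≤
        Real.exp (η * ((Finset.univ.filter fun i => h ∈ S i).card + 1 : ℕ)) - 1 := by
      unfold selWeight
      gcongr
    refine this.trans (le_of_eq ?_)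
    unfold selWeight
    push_cast
    rw [mul_add, mul_one, Real.exp_add]
    ring
  · have hc : (Finset.univ.filter fun i => h ∈ S' i).card ≤
        (Finset.univ.filter fun i => h ∈ S i).card := by
      refine Finset.card_le_card fun i hi => ?_
      by_cases hij : i = j
      · subst hij
        simp only [Finset.mem_filter, Finset.mem_univ, true_and] at hi
        exact absurd hi hj
      · have := hS i hij
        simp only [Finset.mem_filter, Finset.mem_univ, true_and] at hi ⊢
        exact this ▸ hi
    have : selWeight η S' h ≤ selWeight η S h := by
      unfold selWeight
      gcongr
    nlinarith [selWeight_nonneg hη S h]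

/-- Both masses are sums over the union of the two supports, where the additive terms of the weights
number at most `B`. -/
theorem selMass_le_of_eq_off {η : ℝ} (hη : 0 ≤ η) (φ : H → O) {S S' : J → Finset H} {j : J}
    (hS : ∀ i, i ≠ j → S i = S' i) {B : ℕ} (hB : (S' j).card ≤ B) (E : Set O) :
    selMass η φ S' E ≤ Real.exp η * selMass η φ S E + B * (Real.exp η - 1) := by
  classical
  have he : 1 ≤ Real.exp η := Real.one_le_exp hη
  set V := (Finset.univ.biUnion S ∪ Finset.univ.biUnion S').filter fun h => φ h ∈ E with hV
  have h1 : selMass η φ S E = ∑ h ∈ V, selWeight η S h := by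
    refine Finset.sum_subset
      (Finset.filter_subset_filter _ Finset.subset_union_left) fun h hv hn => ?_
    refine selWeight_eq_zero fun hm => hn (Finset.mem_filter.2 ⟨hm, (Finset.mem_filter.1 hv).2⟩)
  have h2 : selMass η φ S' E = ∑ h ∈ V, selWeight η S' h := by
    refine Finset.sum_subset
      (Finset.filter_subset_filter _ Finset.subset_union_right) fun h hv hn => ?_
    refine selWeight_eq_zero fun hm => hn (Finset.mem_filter.2 ⟨hm, (Finset.mem_filter.1 hv).2⟩)
  rw [h1, h2, Finset.mul_sum]
  refine (Finset.sum_le_sum fun h _ => selWeight_le_of_eq_off hη hS h).trans ?_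
  rw [Finset.sum_add_distrib]
  gcongr
  rw [← Finset.sum_filter, Finset.sum_const, nsmul_eq_mul]
  refine mul_le_mul_of_nonneg_right (Nat.cast_le.2 ?_) (by linarith)
  · exact (Finset.card_le_card fun h hh => (Finset.mem_filter.1 hh).2).trans hB

/-- Changing one of the sets changes the output distribution of the selection mechanism only in
the sense of differential privacy. -/
theorem selMeasure_le_of_eq_off [MeasurableSpace O] {η W δ : ℝ} (hη : 0 ≤ η) (φ : H → O) (o : O)
    {S S' : J → Finset H} {j : J} (hS : ∀ i, i ≠ j → S i = S' i) {B : ℕ}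
    (hB : (S j).card ≤ B) (hB' : (S' j).card ≤ B) (hW : 0 < W) (hBW : (B : ℝ) ≤ W)
    (hδ : B * (Real.exp η - 1) ≤ δ * W) {E : Set O} (hE : MeasurableSet E) :
    selMeasure η W φ o S' E ≤
      ENNReal.ofReal (Real.exp (2 * η)) * selMeasure η W φ o S E + ENNReal.ofReal δ := by
  rw [selMeasure_apply hη hW φ o S hE, selMeasure_apply hη hW φ o S' hE]
  have he : 1 ≤ Real.exp η := Real.one_le_exp hη
  set Z := selMass η φ S Set.univ
  set Z' := selMass η φ S' Set.univ
  have hZ : 0 ≤ Z := selMass_nonneg hη φ S Set.univ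
  have hZ' : 0 ≤ Z' := selMass_nonneg hη φ S' Set.univ
  set M := selMass η φ S E
  set M' := selMass η φ S' E
  have hM : 0 ≤ M := selMass_nonneg hη φ S E
  set D := E.indicator (fun _ => W) o
  have hD : 0 ≤ D := Set.indicator_nonneg (fun _ _ => hW.le) _
  have h1 : M' ≤ Real.exp η * M + B * (Real.exp η - 1) := selMass_le_of_eq_off hη φ hS hB' E
  have h2 : Z ≤ Real.exp η * Z' + B * (Real.exp η - 1) :=
    selMass_le_of_eq_off hη φ (fun i hi => (hS i hi).symm) hB Set.univ
  have hδ0 : 0 ≤ δ := by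
    have : 0 ≤ δ * W := le_trans (by have := sub_nonneg.2 he; positivity) hδ
    exact nonneg_of_mul_nonneg_left this hW
  -- The default weight absorbs the additive error of the normalizer because `B ≤ W`. Normalizer and
  -- numerator each cost a factor `exp η`, whence `2 * η`.
  have h3 : Z + W ≤ Real.exp η * (Z' + W) := by nlinarith
  have hZW : 0 < Z + W := by linarith
  have hZW' : 0 < Z' + W := by linarith
  rw [← ENNReal.ofReal_mul (Real.exp_pos _).le, ← ENNReal.ofReal_add (by positivity) hδ0]
  refine ENNReal.ofReal_le_ofReal ?_
  rw [two_mul, Real.exp_add, div_le_iff₀ hZW']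
  -- In the numerator the additive error is at most `δ * W`, which becomes `δ` after division by the
  -- normalizer.
  have h4 : M' + D ≤ Real.exp η * (M + D) + δ * (Z' + W) := by
    nlinarith [mul_nonneg hδ0 hZ', mul_nonneg (sub_nonneg.2 he) hD]
  refine h4.trans ?_
  rw [add_mul]
  refine add_le_add ?_ le_rfl
  rw [mul_assoc, mul_assoc]
  refine mul_le_mul_of_nonneg_left ?_ (Real.exp_pos _).le
  rw [div_mul_eq_mul_div, mul_div_assoc', le_div_iff₀ hZW]
  nlinarith [mul_le_mul_of_nonneg_left h3 (add_nonneg hM hD)]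

/-- If the sets have a common element, the selection mechanism rarely outputs anything that does
not come from a candidate. -/
theorem selMeasure_default_le [MeasurableSpace O] {η W : ℝ} (hη : 0 ≤ η) (hW : 0 < W) (φ : H → O) (o : O)
    (S : J → Finset H) {h₀ : H} (h₀S : ∀ j, h₀ ∈ S j) [Nonempty J] {b : ℝ} (hb : 0 < b)
    (hJ : W / b ≤ Real.exp (η * Fintype.card J) - 1) {E : Set O} (hE : MeasurableSet E)
    (hgood : ∀ j, ∀ h ∈ S j, φ h ∉ E) :
    selMeasure η W φ o S E ≤ ENNReal.ofReal b := by
  classical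
  rw [selMeasure_apply hη hW φ o S hE]
  refine ENNReal.ofReal_le_ofReal ?_
  have h1 : selMass η φ S E = 0 := by
    rw [selMass, Finset.filter_eq_empty_iff.2, Finset.sum_empty]
    intro h hh
    obtain ⟨j, -, hj⟩ := Finset.mem_biUnion.1 hh
    exact hgood j h hj
  have h2 : Real.exp (η * Fintype.card J) - 1 ≤ selMass η φ S Set.univ := by
    have : selWeight η S h₀ ≤ selMass η φ S Set.univ := by
      refine Finset.single_le_sum (f := selWeight η S) (fun h _ => selWeight_nonneg hη S h) ?_
      obtain ⟨j⟩ := ‹Nonempty J›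
      simp only [Set.mem_univ, Finset.filter_true]
      exact Finset.mem_biUnion.2 ⟨j, Finset.mem_univ j, h₀S j⟩
    refine le_trans (le_of_eq ?_) this
    simp [selWeight, h₀S]
  have hZ := selMass_nonneg hη φ S Set.univ
  have hD : E.indicator (fun _ => W) o ≤ W := Set.indicator_le_self' (fun _ _ => hW.le) _
  rw [h1, zero_add, div_le_iff₀ (by linarith)]
  rw [div_le_iff₀ hb] at hJ
  nlinarith

end Selection

/-! ### From candidate sets on blocks to a private learner -/

section Aggregation

variable {X H O K : Type*} [MeasurableSpace X] [MeasurableSpace O] [DecidableEq H] [Countable H]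

/-- The set itself if it has at most `b` elements, and the empty set otherwise. -/
def trim {H : Type*} (b : ℕ) (S : Finset H) : Finset H := if S.card ≤ b then S else ∅

/-- Privacy concerns all data sets, also atypical ones, so the size bound is enforced rather than
assumed. Trimming acts on each set separately and so keeps the effect of one block confined to it.
-/
theorem card_trim_le {H : Type*} (b : ℕ) (S : Finset H) : (trim b S).card ≤ b := by
  unfold trim; split_ifs with h
  · exact h
  · simp

theorem trim_of_le {H : Type*} {b : ℕ} {S : Finset H} (h : S.card ≤ b) : trim b S = S := if_pos h

/-- The selection mechanism as a kernel. -/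
def selKernel (T b : ℕ) (η W : ℝ) (φ : H → O) (o : O) : Kernel (Fin T → Finset H) O :=
  Kernel.ofFunOfCountable fun S => selMeasure η W φ o fun j => trim b (S j)

theorem selKernel_apply (T b : ℕ) (η W : ℝ) (φ : H → O) (o : O) (S : Fin T → Finset H) :
    selKernel T b η W φ o S = selMeasure η W φ o fun j => trim b (S j) := rfl

/-- Run an algorithm with values in finite sets on `T` disjoint data sets and select an element
from the results. -/
def aggKernel (T b : ℕ) (η W : ℝ) (φ : H → O) (o : O) (B : Kernel (K → X) (Finset H))
    [IsMarkovKernel B] : Kernel (Fin T × K → X) O :=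
  selKernel T b η W φ o ∘ₖ
    piKernel fun j : Fin T => B.comap (fun (D : Fin T × K → X) a => D (j, a)) (by fun_prop)

theorem aggKernel_apply (T b : ℕ) (η W : ℝ) (φ : H → O) (o : O) (B : Kernel (K → X) (Finset H))
    [IsMarkovKernel B] (D : Fin T × K → X) {E : Set O} (hE : MeasurableSet E) :
    aggKernel T b η W φ o B D E =
      ∫⁻ S, selKernel T b η W φ o S E ∂(Measure.pi fun j => B fun a => D (j, a)) := by
  rw [aggKernel, Kernel.comp_apply' _ _ _ hE, piKernel_apply]
  rfl

theorem isMarkovKernel_aggKernel (T b : ℕ) {η W : ℝ} (hη : 0 ≤ η) (hW : 0 < W) (φ : H → O) (o : O)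
    (B : Kernel (K → X) (Finset H)) [IsMarkovKernel B] :
    IsMarkovKernel (aggKernel T b η W φ o B) := by
  have : IsMarkovKernel (selKernel T b η W φ o) :=
    ⟨fun S => isProbabilityMeasure_selMeasure hη hW φ o _⟩
  unfold aggKernel
  infer_instance

/-- Neighbouring data sets differ in one block, so the laws of the families of sets are coupled by
resampling one coordinate. The guarantee of the selection mechanism holds pointwise in this coupling
and is then integrated. -/
theorem aggKernel_le [Fintype K] {T b : ℕ} {η W δ : ℝ} (hη : 0 ≤ η) (hW : 0 < W) (hbW : (b : ℝ) ≤ W)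
    (hδ : b * (Real.exp η - 1) ≤ δ * W) (φ : H → O) (o : O)
    (B : Kernel (K → X) (Finset H)) [IsMarkovKernel B] {D D' : Fin T × K → X} {i : Fin T × K}
    (hD : ∀ p, p ≠ i → D p = D' p) {E : Set O} (hE : MeasurableSet E) :
    aggKernel T b η W φ o B D E ≤
      ENNReal.ofReal (Real.exp (2 * η)) * aggKernel T b η W φ o B D' E + ENNReal.ofReal δ := by
  rw [aggKernel_apply _ _ _ _ _ _ _ _ hE, aggKernel_apply _ _ _ _ _ _ _ _ hE]
  set F : (Fin T → Finset H) → ℝ≥0∞ := fun S => selKernel T b η W φ o S E with hF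
  have hFm : Measurable F := Kernel.measurable_coe _ hE
  set ν : Fin T → Measure (Finset H) := fun j => B fun a => D (j, a) with hν
  have hν' : (fun j => B fun a => D' (j, a)) = Function.update ν i.1 (B fun a => D' (i.1, a)) := by
    funext j
    by_cases hj : j = i.1
    · subst hj; simp
    · rw [Function.update_of_ne hj, hν]
      congr 1
      funext a
      exact (hD (j, a) fun h => hj (by rw [← h])).symm
  rw [hν', ← pi_prod_map_update ν i.1 (B fun a => D' (i.1, a)),
    lintegral_map hFm (measurable_of_countable _)]
  have h1 : ∫⁻ S, F S ∂(Measure.pi ν) =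
      ∫⁻ p, F p.1 ∂((Measure.pi ν).prod (B fun a => D' (i.1, a))) :=
    ((measurePreserving_fst (μ := Measure.pi ν)
      (ν := B fun a => D' (i.1, a))).lintegral_comp hFm).symm
  rw [h1]
  have h2 : ∀ p : (Fin T → Finset H) × Finset H, F p.1 ≤
      ENNReal.ofReal (Real.exp (2 * η)) * F (Function.update p.1 i.1 p.2) + ENNReal.ofReal δ := by
    intro p
    refine selMeasure_le_of_eq_off hη φ o (j := i.1) (fun j hj => ?_) (card_trim_le b _)
      (card_trim_le b _) hW hbW hδ hE
    simp only [Function.update_of_ne hj]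
  refine (lintegral_mono h2).trans (le_of_eq ?_)
  rw [lintegral_add_right _ measurable_const, lintegral_const_mul _ (measurable_of_countable _)]
  simp

/-- If each of the finite sets is typically good, then so is the aggregated output. -/
theorem aggKernel_comp_le [Fintype K] {T b : ℕ} (hT : 0 < T) {η W β : ℝ} (hη : 0 ≤ η) (hW : 0 < W)
    (hβ : 0 < β) (hTW : W / β ≤ Real.exp (η * T) - 1) (φ : H → O) (o : O)
    (B : Kernel (K → X) (Finset H)) [IsMarkovKernel B] (μ : Measure X) [IsProbabilityMeasure μ]
    {E : Set O} (hE : MeasurableSet E) (h₀ : H) {G : Set (Finset H)}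
    (hG : ∀ S ∈ G, S.card ≤ b ∧ h₀ ∈ S ∧ ∀ h ∈ S, φ h ∉ E) {β₁ : ℝ≥0∞}
    (hβ₁ : (B ∘ₘ Measure.pi fun _ : K => μ) Gᶜ ≤ β₁) :
    (aggKernel T b η W φ o B ∘ₘ Measure.pi fun _ : Fin T × K => μ) E ≤
      T * β₁ + ENNReal.ofReal β := by
  have hGm : MeasurableSet Gᶜ := (Set.to_countable _).measurableSet
  have := isMarkovKernel_aggKernel T b hη hW φ o B
  have hsel : IsMarkovKernel (selKernel T b η W φ o) :=
    ⟨fun S => isProbabilityMeasure_selMeasure hη hW φ o _⟩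
  have hne : Nonempty (Fin T) := ⟨⟨0, hT⟩⟩
  have h1 : ∀ S : Fin T → Finset H, selKernel T b η W φ o S E ≤
      ∑ j, Gᶜ.indicator 1 (S j) + ENNReal.ofReal β := by
    intro S
    by_cases hS : ∀ j, S j ∈ G
    · refine le_add_left ?_
      rw [selKernel_apply]
      have ht : ∀ j, trim b (S j) = S j := fun j => trim_of_le (hG _ (hS j)).1
      refine selMeasure_default_le hη hW φ o _ (h₀ := h₀) (fun j => ?_) hβ (by simpa using hTW) hE
        fun j h hh => ?_
      · rw [ht]; exact (hG _ (hS j)).2.1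
      · rw [ht] at hh; exact (hG _ (hS j)).2.2 h hh
    · push Not at hS
      obtain ⟨j, hj⟩ := hS
      refine le_add_right ?_
      calc selKernel T b η W φ o S E ≤ 1 := prob_le_one
        _ = Gᶜ.indicator 1 (S j) := by
            rw [Set.indicator_of_mem (show S j ∈ Gᶜ from hj)]; rfl
        _ ≤ _ := Finset.single_le_sum (f := fun j => Gᶜ.indicator (1 : Finset H → ℝ≥0∞) (S j))
            (fun _ _ => zero_le) (Finset.mem_univ j)
  have h2 : ∀ D : Fin T × K → X, aggKernel T b η W φ o B D E ≤
      ∑ j, B (fun a => D (j, a)) Gᶜ + ENNReal.ofReal β := by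
    intro D
    rw [aggKernel_apply _ _ _ _ _ _ _ _ hE]
    refine (lintegral_mono h1).trans (le_of_eq ?_)
    rw [lintegral_add_right _ measurable_const, lintegral_finsetSum _ fun j _ =>
      measurable_of_countable _]
    congr 1
    · refine Finset.sum_congr rfl fun j _ => ?_
      rw [(measurePreserving_eval (fun j => B fun a => D (j, a)) j).lintegral_comp
        (f := Gᶜ.indicator 1) (measurable_of_countable _), lintegral_indicator_one hGm]
    · simp
  rw [Measure.bind_apply hE (Kernel.aemeasurable _)]
  have hBm : Measurable fun y : K → X => B y Gᶜ := B.measurable_coe hGm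
  refine (lintegral_mono h2).trans ?_
  have hBj : ∀ j : Fin T, Measurable fun D : Fin T × K → X => B (fun a => D (j, a)) Gᶜ :=
    fun j => hBm.comp (by fun_prop)
  rw [lintegral_add_right _ measurable_const, lintegral_finsetSum _ fun j _ => hBj j]
  refine add_le_add ?_ (by simp)
  calc ∑ j : Fin T, ∫⁻ D : Fin T × K → X, B (fun a => D (j, a)) Gᶜ ∂(Measure.pi fun _ => μ)
      ≤ ∑ _j : Fin T, β₁ := by
        refine Finset.sum_le_sum fun j _ => le_trans (le_of_eq ?_) hβ₁
        rw [Measure.bind_apply hGm B.aemeasurable]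
        exact (measurePreserving_comp_injective (fun _ : Fin T × K => μ)
          (e := fun a : K => (j, a)) fun a a' h => (Prod.mk.inj h).2).lintegral_comp hBm
    _ = T * β₁ := by simp

/-- Private learning by aggregation: an algorithm whose output on a small data set is a finite set
of candidates that typically contains a fixed candidate and no bad ones yields a private learner. -/
theorem isDPPACLearnableWith_of_finsetKernel {Θ : Type*} [MeasurableSpace Θ] {H K : Type*}
    [Countable H] [Fintype K] (law : Θ → ProbabilityMeasure X) (κ : Θ → Θ → ℝ)
    {T b : ℕ} (hT : 0 < T) (hb : 0 < b) {ε δ α β : ℝ} (hε : 0 < ε) (hδ : 0 < δ) (hβ : 0 < β)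
    (hTb : 2 * (b * (1 + (Real.exp (ε / 2) - 1) / δ)) / β ≤ Real.exp (ε * T / 2) - 1)
    (hκ : ∀ f, MeasurableSet {g | ¬ κ f g ≤ α}) (φ : H → Θ) (o : Θ)
    (B : Kernel (K → X) (Finset H)) [IsMarkovKernel B]
    (hB : ∀ f : Θ, ∃ (h₀ : H) (G : Set (Finset H)),
      (∀ S ∈ G, S.card ≤ b ∧ h₀ ∈ S ∧ ∀ h ∈ S, κ f (φ h) ≤ α) ∧
      (B ∘ₘ Measure.pi fun _ : K => (law f : Measure X)) Gᶜ ≤ ENNReal.ofReal (β / (2 * T))) :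
    IsDPPACLearnableWith law κ (T * Fintype.card K) ε δ α β := by
  classical
  -- The weight is the sum of the two lower bounds `b` and `b * (exp (ε / 2) - 1) / δ` that privacy
  -- requires; `η` is `ε / 2` since the mechanism costs `2 * η`.
  set W : ℝ := b * (1 + (Real.exp (ε / 2) - 1) / δ) with hWdef
  have hη : 0 ≤ ε / 2 := by positivity
  have he : 0 ≤ Real.exp (ε / 2) - 1 := sub_nonneg.2 (Real.one_le_exp hη)
  have hb' : (0 : ℝ) < b := by exact_mod_cast hb
  have hW : 0 < W := by positivity
  have hbW : (b : ℝ) ≤ W := by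
    rw [hWdef]
    have : 0 ≤ b * ((Real.exp (ε / 2) - 1) / δ) := by positivity
    linarith
  have hδW : b * (Real.exp (ε / 2) - 1) ≤ δ * W := by
    have : δ * W = b * (Real.exp (ε / 2) - 1) + δ * b := by
      rw [hWdef]; field_simp; ring
    rw [this]
    have : 0 ≤ δ * b := by positivity
    linarith
  have hcard : Fintype.card (Fin (T * Fintype.card K)) = Fintype.card (Fin T × K) := by simp
  set e : Fin T × K ≃ Fin (T * Fintype.card K) := (Fintype.equivOfCardEq hcard).symm
  set A := aggKernel T b (ε / 2) W φ o B with hA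
  have hAM : IsMarkovKernel A := isMarkovKernel_aggKernel T b hη hW φ o B
  have hm : Measurable fun (D : Fin (T * Fintype.card K) → X) p => D (e p) := by fun_prop
  refine ⟨A.comap _ hm, inferInstance, ?_, ?_⟩
  · have key : ∀ D D' : Fin (T * Fintype.card K) → X, Neighbouring D D' → ∀ E, MeasurableSet E →
        A.comap _ hm D E ≤
          ENNReal.ofReal (Real.exp ε) * A.comap _ hm D' E + ENNReal.ofReal δ := by
      rintro D D' ⟨i, hi⟩ E hE
      rw [Kernel.comap_apply, Kernel.comap_apply]
      have := aggKernel_le hη hW hbW hδW φ o B (D := fun p => D (e p)) (D' := fun p => D' (e p))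
        (i := e.symm i) (fun p hp => hi _ fun h => hp (by rw [← h, e.symm_apply_apply])) hE
      rwa [mul_div_cancel₀ _ (two_ne_zero)] at this
    intro D D' hD E hE
    refine ⟨key D D' hD E hE, key D' D ?_ E hE⟩
    obtain ⟨i, hi⟩ := hD
    exact ⟨i, fun j hj => (hi j hj).symm⟩
  · intro f
    obtain ⟨h₀, G, hG, hGβ⟩ := hB f
    have hT' : (0 : ℝ) < T := by exact_mod_cast hT
    -- Half of `β` pays for the default output, the other half for the `T` blocks.
    have h := aggKernel_comp_le hT hη hW (half_pos hβ)
      (by rw [div_div_eq_mul_div, mul_comm W 2]; refine hTb.trans (le_of_eq ?_); congr 2; ring)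
      φ o B (law f : Measure X) (hκ f) h₀
      (fun S hS => ⟨(hG S hS).1, (hG S hS).2.1, fun h hh => not_not.2 ((hG S hS).2.2 h hh)⟩) hGβ
    have e1 : (A.comap _ hm ∘ₘ Measure.pi fun _ => (law f : Measure X)) {g | ¬ κ f g ≤ α} =
        (A ∘ₘ Measure.pi fun _ : Fin T × K => (law f : Measure X)) {g | ¬ κ f g ≤ α} := by
      rw [Measure.bind_apply (hκ f) (Kernel.aemeasurable _),
        Measure.bind_apply (hκ f) (Kernel.aemeasurable _)]
      exact (measurePreserving_comp_injective (fun _ => (law f : Measure X))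
        e.injective).lintegral_comp (A.measurable_coe (hκ f))
    rw [e1]
    refine h.trans (le_of_eq ?_)
    rw [← ENNReal.ofReal_natCast, ← ENNReal.ofReal_mul hT'.le,
      ← ENNReal.ofReal_add (by positivity) (by positivity)]
    congr 1
    field_simp
    ring

end Aggregation

/-! ### Candidate mixtures and the minimum distance test -/

section Candidates

variable {X C Y : Type*} [MeasurableSpace X] [DecidableEq C]

/-- A measurable set that nearly attains the total variation distance. -/
def nearSepSet (η : ℝ) (P Q : ProbabilityMeasure X) : Set X :=
  if hη : 0 < η then (exists_set_tvDist_lt P Q hη).choose else ∅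

theorem measurableSet_nearSepSet (η : ℝ) (P Q : ProbabilityMeasure X) :
    MeasurableSet (nearSepSet η P Q) := by
  unfold nearSepSet
  split_ifs with hη
  · exact (exists_set_tvDist_lt P Q hη).choose_spec.1
  · exact MeasurableSet.empty

theorem tvDist_lt_nearSepSet {η : ℝ} (hη : 0 < η) (P Q : ProbabilityMeasure X) :
    tvDist P Q < |(P : Measure X).real (nearSepSet η P Q) -
      (Q : Measure X).real (nearSepSet η P Q)| + η := by
  rw [nearSepSet, dif_pos hη]
  exact (exists_set_tvDist_lt P Q hη).choose_spec.2

variable {k : ℕ} (W : Finset (stdSimplex ℝ (Fin k)))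

/-- Mixtures with weights in `W` and components in `C`. -/
abbrev Candidate (C : Type*) : Type _ := W × (Fin k → C)

/-- The mixture represented by a candidate. -/
def Candidate.toKMix {W : Finset (stdSimplex ℝ (Fin k))} (h : Candidate W C) : KMix k C :=
  (h.1.1, h.2)

/-- Mixtures of pairs, of a component and a set of alternatives to it; the alternatives are
dropped. -/
def Candidate.fst {W : Finset (stdSimplex ℝ (Fin k))} (q : Candidate W (C × Finset C)) :
    Candidate W C :=
  (q.1, fun i => (q.2 i).1)

/-- The components from which candidate mixtures are built. -/
def pool {I : Type*} [Fintype I] (pts : Y → Finset (C × Finset C)) (c₀ : C) (y : I → Y) :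
    Finset (C × Finset C) :=
  insert (c₀, {c₀}) (Finset.univ.biUnion fun i => pts (y i))

/-- All mixtures with weights in `W` and components in the pool. -/
def poolMixtures {I : Type*} [Fintype I] (pts : Y → Finset (C × Finset C)) (c₀ : C) (y : I → Y) :
    Finset (Candidate W (C × Finset C)) :=
  Finset.univ ×ˢ Fintype.piFinset fun _ => pool pts c₀ y

theorem mem_poolMixtures {I : Type*} [Fintype I] {pts : Y → Finset (C × Finset C)} {c₀ : C}
    {y : I → Y} {q : Candidate W (C × Finset C)} :
    q ∈ poolMixtures W pts c₀ y ↔ ∀ i, q.2 i ∈ pool pts c₀ y := by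
  simp [poolMixtures]

theorem card_pool_le {I : Type*} [Fintype I] {pts : Y → Finset (C × Finset C)} {L : ℕ}
    (hL : ∀ y, (pts y).card ≤ L) (c₀ : C) (y : I → Y) :
    (pool pts c₀ y).card ≤ Fintype.card I * L + 1 := by
  refine (Finset.card_insert_le _ _).trans (Nat.add_le_add_right ?_ 1)
  refine Finset.card_biUnion_le.trans ?_
  refine (Finset.sum_le_sum fun i _ => hL (y i)).trans ?_
  simp

theorem card_poolMixtures_le {I : Type*} [Fintype I] {pts : Y → Finset (C × Finset C)} {L : ℕ}
    (hL : ∀ y, (pts y).card ≤ L) (c₀ : C) (y : I → Y) :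
    (poolMixtures W pts c₀ y).card ≤ W.card * (Fintype.card I * L + 1) ^ k := by
  rw [poolMixtures, Finset.card_product, Finset.card_univ, Fintype.card_coe,
    Fintype.card_piFinset_const]
  exact Nat.mul_le_mul_left _ (Nat.pow_le_pow_left (card_pool_le hL c₀ y) k)

open scoped Classical in
/-- The mixtures of the pool that pass the minimum distance test on the sample `z`. -/
def keptMixtures {I : Type*} [Fintype I] (claw : C → ProbabilityMeasure X) (η : ℝ)
    (pts : Y → Finset (C × Finset C)) (c₀ : C) {s : ℕ} (y : I → Y) (z : Fin s → X) :
    Finset (Candidate W (C × Finset C)) :=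
  (poolMixtures W pts c₀ y).filter fun q => ∀ q' ∈ poolMixtures W pts c₀ y,
    |(mixLaw claw k q.fst.toKMix : Measure X).real
        (nearSepSet η (mixLaw claw k q.fst.toKMix) (mixLaw claw k q'.fst.toKMix)) -
      empFreq (nearSepSet η (mixLaw claw k q.fst.toKMix) (mixLaw claw k q'.fst.toKMix)) z|
        ≤ 4 * η

/-- The candidates obtained from the mixtures that pass the test by replacing the components by
their alternatives. -/
def candidates {I : Type*} [Fintype I] (claw : C → ProbabilityMeasure X) (η : ℝ)
    (pts : Y → Finset (C × Finset C)) (c₀ : C) {s : ℕ} (y : I → Y) (z : Fin s → X) :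
    Finset (Candidate W C) :=
  (keptMixtures W claw η pts c₀ y z).biUnion fun q =>
    {q.1} ×ˢ Fintype.piFinset fun i => (q.2 i).2

/-- The sample `z` is accurate for `f` on all sets of the minimum distance test. -/
def IsAccurate {I : Type*} [Fintype I] (claw : C → ProbabilityMeasure X) (η : ℝ)
    (pts : Y → Finset (C × Finset C)) (c₀ : C) {s : ℕ} (f : ProbabilityMeasure X) (y : I → Y)
    (z : Fin s → X) : Prop :=
  ∀ q ∈ poolMixtures W pts c₀ y, ∀ q' ∈ poolMixtures W pts c₀ y,
    |(f : Measure X).real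
        (nearSepSet η (mixLaw claw k q.fst.toKMix) (mixLaw claw k q'.fst.toKMix)) -
      empFreq (nearSepSet η (mixLaw claw k q.fst.toKMix) (mixLaw claw k q'.fst.toKMix)) z| ≤ η

section Deterministic

variable {I : Type*} [Fintype I] {claw : C → ProbabilityMeasure X} {η : ℝ}
  {pts : Y → Finset (C × Finset C)} {c₀ : C} {s : ℕ} {y : I → Y} {z : Fin s → X}

theorem mem_candidates {h : Candidate W C} :
    h ∈ candidates W claw η pts c₀ y z ↔
      ∃ q ∈ keptMixtures W claw η pts c₀ y z, h.1 = q.1 ∧ ∀ i, h.2 i ∈ (q.2 i).2 := by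
  simp only [candidates, Finset.mem_biUnion, Finset.mem_product, Finset.mem_singleton,
    Fintype.mem_piFinset]

theorem card_candidates_le {t : ℕ} (ht : 0 < t) (hpts : ∀ y, ∀ p ∈ pts y, p.2.card ≤ t) :
    (candidates W claw η pts c₀ y z).card ≤ (poolMixtures W pts c₀ y).card * t ^ k := by
  classical
  refine (Finset.card_biUnion_le_card_mul _ _ (t ^ k) fun q hq => ?_).trans
    (Nat.mul_le_mul_right _ (Finset.card_le_card (Finset.filter_subset _ _)))
  have hq' := (mem_poolMixtures W).1 (Finset.mem_filter.1 hq).1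
  rw [Finset.card_product, Finset.card_singleton, one_mul, Fintype.card_piFinset]
  calc ∏ i, (q.2 i).2.card ≤ ∏ _i : Fin k, t := by
        refine Finset.prod_le_prod' fun i _ => ?_
        rcases Finset.mem_insert.1 (hq' i) with h | h
        -- The default pair has one alternative, which is where `0 < t` is needed.
        · rw [h]; exact (Finset.card_singleton c₀).le.trans ht
        · obtain ⟨σ, -, hσ⟩ := Finset.mem_biUnion.1 h
          exact hpts _ _ hσ
    _ = t ^ k := by simp

/-- If the pool contains approximations of all substantial components of the mixture `f` and the
sample is accurate, then the candidates are close to `f` and contain a specific one. -/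
theorem candidates_spec {Θ : Type*} {law : Θ → ProbabilityMeasure X} (hη : 0 < η)
    (hpts : ∀ y, ∀ p ∈ pts y, ∀ c ∈ p.2, tvDist (claw c) (claw p.1) ≤ 3 * η)
    (f : KMix k Θ) (v : W) (hv : ∑ i, |f.1.1 i - v.1.1 i| ≤ η) (c : Fin k → C)
    (hpool : ∀ i, 0 < v.1.1 i →
      ∃ σ, ∃ p ∈ pts (y σ), tvDist (law (f.2 i)) (claw p.1) ≤ 2 * η ∧ c i ∈ p.2)
    (hacc : IsAccurate W claw η pts c₀ (mixLaw law k f) y z) :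
    (v, fun i => if 0 < v.1.1 i then c i else c₀) ∈ candidates W claw η pts c₀ y z ∧
      ∀ h ∈ candidates W claw η pts c₀ y z,
        tvDist (mixLaw law k f) (mixLaw claw k h.toKMix) ≤ 15 * η := by
  classical
  have hex : ∀ i, ∃ p ∈ pool pts c₀ y, (0 < v.1.1 i → tvDist (law (f.2 i)) (claw p.1) ≤ 2 * η) ∧
      (if 0 < v.1.1 i then c i else c₀) ∈ p.2 := by
    intro i
    by_cases hi : 0 < v.1.1 i
    · obtain ⟨σ, p, hp, h1, h2⟩ := hpool i hi
      exact ⟨p, Finset.mem_insert_of_mem (Finset.mem_biUnion.2 ⟨σ, Finset.mem_univ _, hp⟩),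
        fun _ => h1, by rwa [if_pos hi]⟩
    -- Components of weight zero need no approximation, but need a fixed value for the common
    -- candidate not to depend on the sample.
    · exact ⟨(c₀, {c₀}), Finset.mem_insert_self _ _, fun h => absurd h hi, by simp [hi]⟩
  choose p hp hp1 hp2 using hex
  set q₀ : Candidate W (C × Finset C) := (v, p) with hq₀
  have hq₀m : q₀ ∈ poolMixtures W pts c₀ y := (mem_poolMixtures W).2 hp
  have hd₀ : tvDist (mixLaw law k f) (mixLaw claw k q₀.fst.toKMix) ≤ 3 * η := by
    have := tvDist_mixLaw_le law claw k f q₀.fst.toKMix hv hp1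
    linarith
  constructor
  -- The representative `q₀` passes the test: `3 * η` for its distance to `f` and `η` for the
  -- sampling error give the threshold `4 * η`.
  · refine (mem_candidates W).2 ⟨q₀, Finset.mem_filter.2 ⟨hq₀m, fun q' hq' => ?_⟩, rfl, hp2⟩
    have h1 := hacc q₀ hq₀m q' hq'
    have h2 := abs_real_sub_real_le_tvDist (mixLaw law k f) (mixLaw claw k q₀.fst.toKMix)
      (measurableSet_nearSepSet η (mixLaw claw k q₀.fst.toKMix) (mixLaw claw k q'.fst.toKMix))
    rw [abs_le] at h1 h2 ⊢
    constructor <;> linarith [h1.1, h1.2, h2.1, h2.2]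
  · intro h hh
    obtain ⟨q, hq, h1, h2⟩ := (mem_candidates W).1 hh
    obtain ⟨hqm, hqt⟩ := Finset.mem_filter.1 hq
    have hm := measurableSet_nearSepSet η (mixLaw claw k q.fst.toKMix)
      (mixLaw claw k q₀.fst.toKMix)
    have e1 := tvDist_lt_nearSepSet hη (mixLaw claw k q.fst.toKMix) (mixLaw claw k q₀.fst.toKMix)
    have e2 := hqt q₀ hq₀m
    have e3 := hacc q hqm q₀ hq₀m
    have e4 := (abs_real_sub_real_le_tvDist (mixLaw law k f) (mixLaw claw k q₀.fst.toKMix) hm)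
    -- Threshold `4 * η`, sampling error `η` and distance `3 * η` of `q₀` from `f` give `8 * η` on
    -- the separating set; its near-optimality costs one more `η`.
    have e5 : tvDist (mixLaw claw k q.fst.toKMix) (mixLaw claw k q₀.fst.toKMix) ≤ 9 * η := by
      refine e1.le.trans ?_
      have : |(mixLaw claw k q.fst.toKMix : Measure X).real
          (nearSepSet η (mixLaw claw k q.fst.toKMix) (mixLaw claw k q₀.fst.toKMix)) -
        (mixLaw claw k q₀.fst.toKMix : Measure X).real
          (nearSepSet η (mixLaw claw k q.fst.toKMix) (mixLaw claw k q₀.fst.toKMix))| ≤ 8 * η := by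
        rw [abs_le] at e2 e3 e4 ⊢
        constructor <;> linarith [e2.1, e2.2, e3.1, e3.2, e4.1, e4.2]
      linarith
    -- Substituting alternatives keeps the weights and moves components by at most `3 * η`; in total
    -- `3 + 9 + 3 = 15`.
    have e6 : tvDist (mixLaw claw k q.fst.toKMix) (mixLaw claw k h.toKMix) ≤ 0 + 3 * η := by
      refine tvDist_mixLaw_le claw claw k _ _ ?_ fun i _ => ?_
      · simp [Candidate.toKMix, Candidate.fst, h1]
      · rw [tvDist_comm]
        rcases Finset.mem_insert.1 ((mem_poolMixtures W).1 hqm i) with h | h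
        · have h2i := h2 i
          rw [h, Finset.mem_singleton] at h2i
          simp only [Candidate.toKMix, Candidate.fst, h, h2i, tvDist_self]
          positivity
        · obtain ⟨σ, -, hσ⟩ := Finset.mem_biUnion.1 h
          exact hpts _ _ hσ _ (h2 i)
    have e7 := tvDist_triangle (mixLaw law k f) (mixLaw claw k q₀.fst.toKMix)
      (mixLaw claw k q.fst.toKMix)
    have e8 := tvDist_triangle (mixLaw law k f) (mixLaw claw k q.fst.toKMix)
      (mixLaw claw k h.toKMix)
    rw [tvDist_comm (mixLaw claw k q₀.fst.toKMix)] at e7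
    linarith

end Deterministic

section Probability

variable {I : Type*} [Fintype I] (claw : C → ProbabilityMeasure X) (η : ℝ)
  (pts : Y → Finset (C × Finset C)) (c₀ : C) {s : ℕ}

theorem measurable_keptMixtures [Countable C] (y : I → Y) :
    Measurable fun z : Fin s → X => keptMixtures W claw η pts c₀ y z := by
  classical
  refine measurable_finset_iff.2 fun q => ?_
  simp only [keptMixtures, Finset.mem_filter]
  refine Measurable.and measurable_const (Measurable.forall fun q' =>
    Measurable.imp measurable_const (measurableSet_setOfPred.1 (measurableSet_le ?_
      measurable_const)))
  · exact ((measurable_empFreq (measurableSet_nearSepSet _ _ _)).const_sub _).abs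

/-- Since `I → Y` is countable, joint measurability reduces to measurability in the test sample. -/
theorem measurable_candidates [Countable C] [MeasurableSpace Y] [Countable Y] [MeasurableSingletonClass Y] :
    Measurable fun p : (I → Y) × (Fin s → X) => candidates W claw η pts c₀ p.1 p.2 := by
  refine measurable_from_prod_countable_right fun y => ?_
  exact (measurable_of_countable fun S : Finset (Candidate W (C × Finset C)) =>
    S.biUnion fun q => {q.1} ×ˢ Fintype.piFinset fun i => (q.2 i).2).comp
      (measurable_keptMixtures W claw η pts c₀ y)

theorem measurableSet_not_isAccurate [Countable C] [MeasurableSpace Y] [Countable Y]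
    [MeasurableSingletonClass Y] (f : ProbabilityMeasure X) :
    MeasurableSet {p : (I → Y) × (Fin s → X) | ¬ IsAccurate W claw η pts c₀ f p.1 p.2} := by
  refine measurableSet_setOfPred.2 (measurable_from_prod_countable_right fun y => ?_)
  refine Measurable.not (Measurable.forall fun q => Measurable.imp
    (measurable_const (a := q ∈ poolMixtures W pts c₀ y)) (Measurable.forall fun q' =>
      Measurable.imp (measurable_const (a := q' ∈ poolMixtures W pts c₀ y))
        (measurableSet_setOfPred.1 (measurableSet_le ?_ measurable_const))))
  · exact ((measurable_empFreq (measurableSet_nearSepSet _ _ _)).const_sub _).abs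

/-- Hoeffding's inequality and a union bound for the minimum distance test. -/
theorem measure_not_isAccurate_le (hη : 0 ≤ η) (hs : 0 < s) (f : ProbabilityMeasure X)
    (y : I → Y) {b : ℕ} (hb : (poolMixtures W pts c₀ y).card ≤ b) :
    (Measure.pi fun _ : Fin s => (f : Measure X)) {z | ¬ IsAccurate W claw η pts c₀ f y z} ≤
      ENNReal.ofReal (2 * b ^ 2 * Real.exp (-2 * s * η ^ 2)) := by
  set Q := poolMixtures W pts c₀ y
  set A : Candidate W (C × Finset C) × Candidate W (C × Finset C) → Set X := fun r =>
    nearSepSet η (mixLaw claw k r.1.fst.toKMix) (mixLaw claw k r.2.fst.toKMix)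
  -- The sets of the test depend on `y` only and are fixed before `z` is drawn, so a union bound
  -- over pairs from the pool suffices.
  have hsub : {z : Fin s → X | ¬ IsAccurate W claw η pts c₀ f y z} ⊆
      ⋃ r ∈ Q ×ˢ Q, {z | η < |(f : Measure X).real (A r) - empFreq (A r) z|} := by
    intro z hz
    have hz' : ¬ IsAccurate W claw η pts c₀ f y z := hz
    simp only [IsAccurate] at hz'
    push Not at hz'
    obtain ⟨q, hq, q', hq', h⟩ := hz'
    exact Set.mem_biUnion (Finset.mem_product.2 ⟨hq, hq'⟩ : (q, q') ∈ Q ×ˢ Q) h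
  refine (measure_mono hsub).trans ((measure_biUnion_finset_le _ _).trans ?_)
  refine (Finset.sum_le_sum fun r _ =>
    measure_empFreq_le f hs (measurableSet_nearSepSet η _ _) hη).trans ?_
  rw [Finset.sum_const, Finset.card_product, nsmul_eq_mul, ← ENNReal.ofReal_natCast,
    ← ENNReal.ofReal_mul (by positivity)]
  refine ENNReal.ofReal_le_ofReal ?_
  push_cast
  have hb' : (Q.card : ℝ) ≤ b := by exact_mod_cast hb
  calc (Q.card : ℝ) * Q.card * (2 * Real.exp (-2 * s * η ^ 2))
      ≤ b * b * (2 * Real.exp (-2 * s * η ^ 2)) := by gcongr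
    _ = _ := by ring

end Probability

section CandidateKernel

variable [Countable C] [MeasurableSpace Y] [Countable Y] [MeasurableSingletonClass Y] {m : ℕ}

/-- The algorithm that computes a finite set of candidates: the first part of the data is used to
build mixtures, the second one to test them. -/
def candidateKernel (claw : C → ProbabilityMeasure X) (η : ℝ) (pts : Y → Finset (C × Finset C))
    (c₀ : C) (A : Kernel (Fin m → X) Y) [IsMarkovKernel A] (s s' : ℕ) :
    Kernel (Fin s ⊕ Fin s' → X) (Finset (Candidate W C)) :=
  (((allTuplesKernel A s).comap (fun (x : Fin s ⊕ Fin s' → X) j => x (Sum.inl j))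
      (by fun_prop)) ×ₖ
    Kernel.deterministic (fun (x : Fin s ⊕ Fin s' → X) j => x (Sum.inr j)) (by fun_prop)).map
      fun p => candidates W claw η pts c₀ p.1 p.2

instance isMarkovKernel_candidateKernel (claw : C → ProbabilityMeasure X) (η : ℝ)
    (pts : Y → Finset (C × Finset C)) (c₀ : C) (A : Kernel (Fin m → X) Y) [IsMarkovKernel A]
    (s s' : ℕ) : IsMarkovKernel (candidateKernel W claw η pts c₀ A s s') := by
  unfold candidateKernel
  exact Kernel.IsMarkovKernel.map _ (measurable_candidates W claw η pts c₀)

theorem candidateKernel_apply (claw : C → ProbabilityMeasure X) (η : ℝ)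
    (pts : Y → Finset (C × Finset C)) (c₀ : C) (A : Kernel (Fin m → X) Y) [IsMarkovKernel A]
    (s s' : ℕ) (x : Fin s ⊕ Fin s' → X) (U : Set (Finset (Candidate W C))) :
    candidateKernel W claw η pts c₀ A s s' x U =
      allTuplesKernel A s (fun j => x (Sum.inl j))
        {y | candidates W claw η pts c₀ y (fun j => x (Sum.inr j)) ∈ U} := by
  have hU : MeasurableSet U := (Set.to_countable _).measurableSet
  have hm := measurable_candidates (I := Fin m → Fin s) (s := s') W claw η pts c₀
  rw [candidateKernel, Kernel.map_apply' _ hm _ hU, Kernel.prod_apply, Kernel.comap_apply,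
    Kernel.deterministic_apply, Measure.prod_apply_symm (hm hU), lintegral_dirac']
  · rfl
  · exact measurable_measure_prodMk_right (hm hU)

/-- A block fails only if some component charged by `v` is missed by all runs, or if the test sample
is inaccurate. Amplification bounds the first event, since such components have true weight at least
`θ`; Hoeffding's inequality bounds the second. The common candidate consists of `v`, `c` and the
default, none of which depends on the data. -/
theorem candidateKernel_comp_le {Θ : Type*} {law : Θ → ProbabilityMeasure X}
    {claw : C → ProbabilityMeasure X} {η : ℝ} (hη : 0 < η)
    {pts : Y → Finset (C × Finset C)} {L t : ℕ} (ht : 0 < t) (hL : ∀ y, (pts y).card ≤ L)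
    (hcard : ∀ y, ∀ p ∈ pts y, p.2.card ≤ t)
    (hpts : ∀ y, ∀ p ∈ pts y, ∀ c ∈ p.2, tvDist (claw c) (claw p.1) ≤ 3 * η) (c₀ : C)
    (A : Kernel (Fin m → X) Y) [IsMarkovKernel A] (hm : 0 < m) (s s' r : ℕ) (hs' : 0 < s')
    (f : KMix k Θ) (v : W) (hv : ∑ i, |f.1.1 i - v.1.1 i| ≤ η) (c : Fin k → C) {θ : ℝ}
    (hθ : ∀ i, 0 < v.1.1 i → θ ≤ f.1.1 i) {b : ℝ} (hb : 0 ≤ b)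
    (hA : ∀ i, (A ∘ₘ Measure.pi fun _ : Fin m => (law (f.2 i) : Measure X))
      {y | ¬ ∃ p ∈ pts y, tvDist (law (f.2 i)) (claw p.1) ≤ 2 * η ∧ c i ∈ p.2} ≤
        ENNReal.ofReal b) :
    ∃ h₀ : Candidate W C, (candidateKernel W claw η pts c₀ A s s' ∘ₘ
      Measure.pi fun _ : Fin s ⊕ Fin s' => (mixLaw law k f : Measure X))
      {S | S.card ≤ W.card * (s ^ m * L + 1) ^ k * t ^ k ∧ h₀ ∈ S ∧
        ∀ h ∈ S, tvDist (mixLaw law k f) (mixLaw claw k h.toKMix) ≤ 15 * η}ᶜ ≤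
      ENNReal.ofReal (k * (Real.exp (r * m - θ * s / 2) + b ^ r) +
        2 * (W.card * (s ^ m * L + 1) ^ k : ℕ) ^ 2 * Real.exp (-2 * s' * η ^ 2)) := by
  refine ⟨(v, fun i => if 0 < v.1.1 i then c i else c₀), ?_⟩
  set P : ProbabilityMeasure X := mixLaw law k f with hP
  set G : Set (Finset (Candidate W C)) :=
    {S | S.card ≤ W.card * (s ^ m * L + 1) ^ k * t ^ k ∧
        (v, fun i => if 0 < v.1.1 i then c i else c₀) ∈ S ∧
        ∀ h ∈ S, tvDist P (mixLaw claw k h.toKMix) ≤ 15 * η} with hG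
  set bad : Fin k → Set Y := fun i =>
    {y | ¬ ∃ p ∈ pts y, tvDist (law (f.2 i)) (claw p.1) ≤ 2 * η ∧ c i ∈ p.2} with hbad
  have hbadm : ∀ i, MeasurableSet (bad i) := fun i => (Set.to_countable _).measurableSet
  have hGm : MeasurableSet Gᶜ := (Set.to_countable _).measurableSet
  have hsize : ∀ y : (Fin m → Fin s) → Y,
      (poolMixtures W pts c₀ y).card ≤ W.card * (s ^ m * L + 1) ^ k := by
    intro y
    simpa using card_poolMixtures_le W hL c₀ y
  set K := allTuplesKernel A s
  set heavy : Finset (Fin k) := Finset.univ.filter fun i => 0 < v.1.1 i with hheavy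
  set g : (Fin s → X) → ℝ≥0∞ := fun x => ∑ i ∈ heavy, K x {y | ∀ σ, y σ ∈ bad i} with hg
  have hgm' : ∀ i, Measurable fun x : Fin s → X => K x {y | ∀ σ, y σ ∈ bad i} := fun i =>
    K.measurable_coe (measurableSet_forall_mem (hbadm i))
  have hgm : Measurable g := Finset.measurable_sum _ fun i _ => hgm' i
  set N : Set (((Fin m → Fin s) → Y) × (Fin s' → X)) :=
    {p | ¬ IsAccurate W claw η pts c₀ P p.1 p.2} with hN
  have hNm : MeasurableSet N := measurableSet_not_isAccurate W claw η pts c₀ P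
  have hpoint : ∀ x : Fin s ⊕ Fin s' → X, candidateKernel W claw η pts c₀ A s s' x Gᶜ ≤
      g (fun j => x (Sum.inl j)) +
        K (fun j => x (Sum.inl j)) ((fun y => (y, fun j => x (Sum.inr j))) ⁻¹' N) := by
    intro x
    rw [candidateKernel_apply]
    have hsub : {y | candidates W claw η pts c₀ y (fun j => x (Sum.inr j)) ∈ Gᶜ} ⊆
        (⋃ i ∈ heavy, {y | ∀ σ, y σ ∈ bad i}) ∪
          ((fun y => (y, fun j => x (Sum.inr j))) ⁻¹' N) := by
      intro y hy
      by_contra hcon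
      simp only [Set.mem_union, not_or, Set.mem_iUnion, not_exists] at hcon
      obtain ⟨h1, h2⟩ := hcon
      refine hy ?_
      have hacc : IsAccurate W claw η pts c₀ P y (fun j => x (Sum.inr j)) := not_not.1 h2
      have hpool : ∀ i, 0 < v.1.1 i →
          ∃ σ, ∃ p ∈ pts (y σ), tvDist (law (f.2 i)) (claw p.1) ≤ 2 * η ∧ c i ∈ p.2 := by
        intro i hi
        by_contra hno
        push Not at hno
        refine h1 i (Finset.mem_filter.2 ⟨Finset.mem_univ i, hi⟩) fun σ => ?_
        rintro ⟨p, hp, hp1, hp2⟩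
        exact hno σ p hp hp1 hp2
      obtain ⟨h3, h4⟩ := candidates_spec W hη hpts f v hv c hpool hacc
      exact ⟨(card_candidates_le W ht hcard).trans (Nat.mul_le_mul_right _ (hsize y)), h3, h4⟩
    refine (measure_mono hsub).trans ((measure_union_le _ _).trans ?_)
    gcongr
    exact measure_biUnion_finset_le _ _
  have h1 : ∫⁻ x : Fin s ⊕ Fin s' → X, g (fun j => x (Sum.inl j)) ∂(Measure.pi fun _ => (P : Measure X))
      ≤ ENNReal.ofReal (k * (Real.exp (r * m - θ * s / 2) + b ^ r)) := by
    rw [(measurePreserving_comp_injective (fun _ : Fin s ⊕ Fin s' => (P : Measure X))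
      Sum.inl_injective).lintegral_comp hgm, hg, lintegral_finsetSum _ fun i _ => hgm' i]
    calc ∑ i ∈ heavy, ∫⁻ x, K x {y | ∀ σ, y σ ∈ bad i} ∂(Measure.pi fun _ => (P : Measure X))
        ≤ ∑ _i ∈ heavy, ENNReal.ofReal (Real.exp (r * m - θ * s / 2) + b ^ r) := by
          refine Finset.sum_le_sum fun i hi => ?_
          have := allTuplesKernel_mixture_le A hm s r (hbadm i)
            (fun i => (law (f.2 i) : Measure X)) (fun i => f.1.1 i) f.1.2.1 f.1.2.2 i (hA i)
          rw [Measure.bind_apply (measurableSet_forall_mem (hbadm i)) (Kernel.aemeasurable _)]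
            at this
          refine this.trans ?_
          rw [← ENNReal.ofReal_pow hb, ← ENNReal.ofReal_add (Real.exp_pos _).le (by positivity)]
          refine ENNReal.ofReal_le_ofReal ?_
          have := hθ i (Finset.mem_filter.1 hi).2
          gcongr
      _ ≤ ∑ _i : Fin k, ENNReal.ofReal (Real.exp (r * m - θ * s / 2) + b ^ r) :=
          Finset.sum_le_sum_of_subset (Finset.subset_univ _)
      _ = _ := by
          rw [Finset.sum_const, Finset.card_univ, Fintype.card_fin, nsmul_eq_mul,
            ENNReal.ofReal_mul (by positivity), ENNReal.ofReal_natCast]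
  have hF : Measurable fun p : (Fin s → X) × (Fin s' → X) =>
      K p.1 ((fun y => (y, p.2)) ⁻¹' N) := by
    exact Kernel.measurable_kernel_prodMk_left
      (κ := K.comap (fun p : (Fin s → X) × (Fin s' → X) => p.1) measurable_fst)
      (t := (fun q : ((Fin s → X) × (Fin s' → X)) × ((Fin m → Fin s) → Y) => (q.2, q.1.2)) ⁻¹' N)
      (hNm.preimage (by fun_prop))
  have h2 : ∫⁻ x : Fin s ⊕ Fin s' → X,
      K (fun j => x (Sum.inl j)) ((fun y => (y, fun j => x (Sum.inr j))) ⁻¹' N)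
        ∂(Measure.pi fun _ => (P : Measure X)) ≤
      ENNReal.ofReal (2 * (W.card * (s ^ m * L + 1) ^ k : ℕ) ^ 2 *
        Real.exp (-2 * s' * η ^ 2)) := by
    have hmp := measurePreserving_sumPiEquivProdPi
      (fun _ : Fin s ⊕ Fin s' => (P : Measure X))
    have e := hmp.lintegral_comp hF
    refine (le_of_eq e).trans ?_
    rw [lintegral_prod _ hF.aemeasurable]
    refine (lintegral_mono (g := fun _ => ENNReal.ofReal (2 * (W.card * (s ^ m * L + 1) ^ k : ℕ) ^ 2 *
        Real.exp (-2 * s' * η ^ 2))) fun x => ?_).trans (by simp)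
    -- The order of integration is exchanged so that the test sample is integrated for a fixed
    -- outcome `y` of the decoding runs.
    refine (le_of_eq (Measure.prod_apply_symm (μ := K x) hNm).symm).trans ?_
    rw [Measure.prod_apply hNm]
    refine (lintegral_mono fun y => measure_not_isAccurate_le W claw η pts c₀ hη.le hs' P y
      (hsize y)).trans (by simp)
  rw [Measure.bind_apply hGm (Kernel.aemeasurable _)]
  refine (lintegral_mono hpoint).trans ?_
  have hgl : Measurable fun x : Fin s ⊕ Fin s' → X => g fun j => x (Sum.inl j) :=
    hgm.comp (by fun_prop)
  rw [lintegral_add_left hgl, ENNReal.ofReal_add (by positivity)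
    (by positivity)]
  exact add_le_add h1 h2

end CandidateKernel

end Candidates

/-! ### Rounding lists to the cover -/

section Rounding

variable {Θ X : Type*} [MeasurableSpace X] {law : Θ → ProbabilityMeasure X} {C : Set Θ}

open scoped Classical in
/-- The elements of `C` within distance `r` of `g`. -/
def nearFinset (law : Θ → ProbabilityMeasure X) (C : Set Θ) (r : ℝ) (g : Θ) : Finset C :=
  if h : {c : C | tvOn law c g ≤ r}.Finite then h.toFinset else ∅

theorem IsLocallySmall.mono_radius {t : ℕ} {γ r : ℝ} (hC : IsLocallySmall (tvOn law) t γ C)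
    (hr : r ≤ γ) : IsLocallySmall (tvOn law) t r C := fun f =>
  by
  refine le_trans (Set.encard_le_encard ?_) (hC f)
  rintro c ⟨h1, h2⟩
  exact ⟨h1, le_trans h2 hr⟩

theorem IsLocallySmall.encard_le {t : ℕ} {r : ℝ} (hC : IsLocallySmall (tvOn law) t r C) (g : Θ) :
    {c : C | tvOn law c g ≤ r}.encard ≤ t := by
  refine le_trans (le_of_eq ?_) (hC g)
  rw [← Subtype.val_injective.encard_image]
  congr 1
  ext c
  constructor
  · rintro ⟨c, hc, rfl⟩; exact ⟨c.2, hc⟩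
  · rintro ⟨h, hc⟩; exact ⟨⟨c, h⟩, hc, rfl⟩

theorem IsLocallySmall.finite {t : ℕ} {r : ℝ} (hC : IsLocallySmall (tvOn law) t r C) (g : Θ) :
    {c : C | tvOn law c g ≤ r}.Finite :=
  Set.encard_ne_top_iff.1 ((hC.encard_le g).trans_lt (WithTop.coe_lt_top t)).ne

theorem mem_nearFinset {t : ℕ} {r : ℝ} (hC : IsLocallySmall (tvOn law) t r C) {g : Θ} {c : C} :
    c ∈ nearFinset law C r g ↔ tvOn law c g ≤ r := by
  rw [nearFinset, dif_pos (hC.finite g), Set.Finite.mem_toFinset]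
  rfl

theorem card_nearFinset_le {t : ℕ} {r : ℝ} (hC : IsLocallySmall (tvOn law) t r C) (g : Θ) :
    (nearFinset law C r g).card ≤ t := by
  have h := hC.encard_le g
  rw [(hC.finite g).encard_eq_coe_toFinset_card] at h
  rw [nearFinset, dif_pos (hC.finite g)]
  exact_mod_cast h

theorem measurable_nearFinset [MeasurableSpace Θ] [MeasurableSpace.CountablyGenerated X]
    (hlaw : Measurable law) {t : ℕ} {r : ℝ} (hC : IsLocallySmall (tvOn law) t r C) :
    Measurable (nearFinset law C r) := by
  refine measurable_finset_iff.2 fun c => ?_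
  simp only [mem_nearFinset hC, tvOn]
  refine measurableSet_setOfPred.1 (measurableSet_le ?_ measurable_const)
  simp only [tvDist_comm (law c)]
  exact (measurable_tvDist (law c)).comp hlaw

/-- Lists of at most `L` pairs of an element of `C` and a small set of alternatives to it, up to
order. -/
abbrev RoundedList (law : Θ → ProbabilityMeasure X) (C : Set Θ) (ρ : ℝ) (L t : ℕ) : Type _ :=
  {y : Finset (C × Finset C) // y.card ≤ L ∧ ∀ p ∈ y, p.2.card ≤ t ∧
    ∀ c ∈ p.2, tvDist (law c) (law p.1) ≤ 3 * ρ}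

/-- An element of a finite set, if there is one. -/
def pickElement {C : Type*} (c₀ : C) (S : Finset C) : C :=
  open scoped Classical in if h : S.Nonempty then h.choose else c₀

theorem pickElement_mem {C : Type*} (c₀ : C) {S : Finset C} (h : S.Nonempty) :
    pickElement c₀ S ∈ S := by
  rw [pickElement, dif_pos h]; exact h.choose_spec

open scoped Classical in
/-- Round the members of a list to `C`, and record the elements of `C` near to them. -/
def roundFinset (law : Θ → ProbabilityMeasure X) (C : Set Θ) (c₀ : C) (ρ : ℝ) {L : ℕ}
    (l : ListUpTo L Θ) : Finset (C × Finset C) :=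
  Finset.univ.image fun i =>
    (pickElement c₀ (nearFinset law C ρ (l.2 i)), nearFinset law C (2 * ρ) (l.2 i))

theorem measurable_of_sigma {ι β : Type*} {α : ι → Type*} [∀ i, MeasurableSpace (α i)]
    [MeasurableSpace β] {f : Sigma α → β} (hf : ∀ i, Measurable fun a => f ⟨i, a⟩) :
    Measurable f :=
  fun _ hs => MeasurableSpace.measurableSet_iInf.2 fun i => hf i hs

theorem measurable_roundFinset [MeasurableSpace Θ] [MeasurableSpace.CountablyGenerated X]
    (hlaw : Measurable law) (hCc : C.Countable) {t : ℕ} {ρ : ℝ} (hρ : 0 ≤ ρ)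
    (hC : IsLocallySmall (tvOn law) t (2 * ρ) C) (c₀ : C) (L : ℕ) :
    Measurable (roundFinset law C c₀ ρ : ListUpTo L Θ → Finset (C × Finset C)) := by
  classical
  have := hCc.to_subtype
  refine measurable_of_sigma fun n => ?_
  have h1 : Measurable fun (g : Fin n.1 → Θ) (i : Fin n.1) =>
      (nearFinset law C ρ (g i), nearFinset law C (2 * ρ) (g i)) := by
    refine measurable_pi_lambda _ fun i => Measurable.prodMk ?_ ?_
    · exact (measurable_nearFinset hlaw (hC.mono_radius (by linarith))).comp (measurable_pi_apply i)
    · exact (measurable_nearFinset hlaw hC).comp (measurable_pi_apply i)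
  exact (measurable_of_countable fun u : Fin n.1 → Finset C × Finset C =>
    Finset.univ.image fun i => (pickElement c₀ (u i).1, (u i).2)).comp h1

theorem tvOn_pickElement_le {t : ℕ} {ρ : ℝ} (hcov : IsCover (tvOn law) ρ C)
    (hC : IsLocallySmall (tvOn law) t ρ C) (c₀ : C) (g : Θ) :
    tvOn law (pickElement c₀ (nearFinset law C ρ g) : C) g ≤ ρ := by
  refine (mem_nearFinset hC).1 (pickElement_mem c₀ ?_)
  obtain ⟨c, hc, h⟩ := hcov g
  refine ⟨⟨c, hc⟩, (mem_nearFinset hC).2 ?_⟩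
  rwa [tvOn, tvDist_comm]

/-- An alternative is within `2 * ρ` and the representative within `ρ` of the same list member. This
holds for every list, good or bad, so rounded lists can be made into a type carrying these bounds.
-/
theorem roundFinset_spec {t : ℕ} {ρ : ℝ} (hρ : 0 ≤ ρ) (hcov : IsCover (tvOn law) ρ C)
    (hC : IsLocallySmall (tvOn law) t (2 * ρ) C) (c₀ : C) {L : ℕ} (l : ListUpTo L Θ) :
    (roundFinset law C c₀ ρ l).card ≤ L ∧ ∀ p ∈ roundFinset law C c₀ ρ l, p.2.card ≤ t ∧
      ∀ c ∈ p.2, tvDist (law c) (law p.1) ≤ 3 * ρ := by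
  classical
  constructor
  · refine Finset.card_image_le.trans ?_
    rw [Finset.card_univ, Fintype.card_fin]
    exact Nat.lt_succ_iff.1 l.1.2
  · intro p hp
    obtain ⟨i, -, rfl⟩ := Finset.mem_image.1 hp
    refine ⟨card_nearFinset_le hC _, fun c hc => ?_⟩
    have h1 := (mem_nearFinset hC).1 hc
    have h2 := tvOn_pickElement_le hcov (hC.mono_radius (by linarith)) c₀ (l.2 i)
    have h3 := tvDist_triangle (law c) (law (l.2 i))
      (law (pickElement c₀ (nearFinset law C ρ (l.2 i)) : C))
    rw [tvOn] at h1 h2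
    rw [tvDist_comm (law (l.2 i))] at h3
    linarith

/-- If the list contains a good approximation, so does the rounded list. -/
theorem exists_mem_roundFinset {t : ℕ} {ρ : ℝ} (hρ : 0 ≤ ρ) (hcov : IsCover (tvOn law) ρ C)
    (hC : IsLocallySmall (tvOn law) t (2 * ρ) C) (c₀ : C) {L : ℕ} (l : ListUpTo L Θ) {f : Θ}
    (hl : ∃ i, tvOn law (l.2 i) f ≤ ρ) {c : C} (hc : tvOn law f c ≤ ρ) :
    ∃ p ∈ roundFinset law C c₀ ρ l, tvDist (law f) (law p.1) ≤ 2 * ρ ∧ c ∈ p.2 := by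
  classical
  obtain ⟨i, hi⟩ := hl
  refine ⟨_, Finset.mem_image_of_mem _ (Finset.mem_univ i), ?_, (mem_nearFinset hC).2 ?_⟩
  · have h2 := tvOn_pickElement_le hcov (hC.mono_radius (by linarith)) c₀ (l.2 i)
    have h3 := tvDist_triangle (law f) (law (l.2 i))
      (law (pickElement c₀ (nearFinset law C ρ (l.2 i)) : C))
    rw [tvOn] at h2 hi
    rw [tvDist_comm (law (l.2 i)), tvDist_comm (law f) (law (l.2 i))] at h3
    simp only
    linarith
  -- Both `c` and the list member are `ρ`-close to `f`; this is why the cover must be locally small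
  -- at radius `2 * ρ`.
  · have h3 := tvDist_triangle (law c) (law f) (law (l.2 i))
    rw [tvOn] at hi hc ⊢
    rw [tvDist_comm (law c) (law f), tvDist_comm (law f) (law (l.2 i))] at h3
    linarith

end Rounding

/-! ### The reduction with explicit parameters -/

section Reduction

variable {Θ X : Type*} [MeasurableSpace X]

theorem huber_zero (f h : ProbabilityMeasure X) : huber 0 f h = (f : Measure X) := by
  simp [huber]

/-- An empty list fails with probability one. Positivity of `L` and of `t` makes their logarithms
nonnegative in the choice of parameters. -/
theorem IsListDecodable.list_pos [MeasurableSpace Θ] [hΘ : Nonempty Θ]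
    {law : Θ → ProbabilityMeasure X} {κ : Θ → Θ → ℝ} {L m : ℕ} {α β γ : ℝ}
    (hβ : β < 1) (hγ : γ = 0) (h : IsListDecodable law κ L m α β γ) : 0 < L := by
  subst hγ
  obtain ⟨A, hA, hdec⟩ := h
  obtain ⟨f⟩ := hΘ
  by_contra hL
  have hL0 : L = 0 := by omega
  subst hL0
  have h1 := hdec f (law f)
  have : {l : ListUpTo 0 Θ | ¬ ∃ i, κ (l.2 i) f ≤ α} = Set.univ := by
    refine Set.eq_univ_of_forall fun l => ?_
    rintro ⟨i, -⟩
    have := i.2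
    have := l.1.2
    omega
  rw [this, huber_zero, Measure.comp_apply_univ, measure_univ] at h1
  have h2 : ENNReal.ofReal β < 1 := by
    rw [← ENNReal.ofReal_one]
    exact (ENNReal.ofReal_lt_ofReal_iff one_pos).2 hβ
  exact absurd h1 (not_le.2 h2)

/-- The cover point assigned to a member lies in the ball around this member. -/
theorem IsLocallySmall.pos [hΘ : Nonempty Θ] {law : Θ → ProbabilityMeasure X} {t : ℕ} {ρ γ : ℝ}
    {C : Set Θ} (hγ : ρ ≤ γ) (hcov : IsCover (tvOn law) ρ C)
    (hC : IsLocallySmall (tvOn law) t γ C) : 0 < t := by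
  obtain ⟨f⟩ := hΘ
  obtain ⟨c, hc, h⟩ := hcov f
  have h1 := hC f
  by_contra ht
  have ht0 : t = 0 := by omega
  subst ht0
  have h2 : {f' ∈ C | tvOn law f' f ≤ γ} = ∅ := by simpa using h1
  have h3 : c ∈ {f' ∈ C | tvOn law f' f ≤ γ} := ⟨hc, by
    rw [tvOn, tvDist_comm]; exact h.trans hγ⟩
  rw [h2] at h3
  exact h3

theorem measurableSet_not_tvOn_mixLaw_le [MeasurableSpace Θ]
    [MeasurableSpace.CountablyGenerated X] {law : Θ → ProbabilityMeasure X}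
    (hlaw : Measurable law) (k : ℕ) (α : ℝ) (f : KMix k Θ) :
    MeasurableSet {g | ¬ tvOn (mixLaw law k) f g ≤ α} := by
  have : Measurable fun g => tvOn (mixLaw law k) f g := by
    simp only [tvOn, tvDist_comm (mixLaw law k f)]
    exact (measurable_tvDist _).comp (measurable_mixLaw hlaw k)
  exact (measurableSet_le this measurable_const).compl

/-- The reduction, with explicit parameters: `T` data sets consisting of `s` samples for list
decoding and `s'` samples for testing, and a net of weights of resolution `1 / G`. -/
theorem isDPPACLearnableWith_mixLaw [MeasurableSpace Θ] [MeasurableSpace.CountablyGenerated X]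
    [Nonempty Θ] {law : Θ → ProbabilityMeasure X} (hlaw : Measurable law) {C : Set Θ}
    (hCc : C.Countable) {t L m k : ℕ} {α β β' ε δ : ℝ} (hm : 0 < m) (hk : 0 < k) (hα : 0 < α)
    (hβ : 0 < β) (hβ' : 0 < β') (hε : 0 < ε) (hδ : 0 < δ)
    (hcov : IsCover (tvOn law) (α / 15) C) (hC : IsLocallySmall (tvOn law) t (2 * α / 15) C)
    (hdec : IsListDecodable law (tvOn law) L m (α / 15) β' 0) {T s s' r G : ℕ} (hT : 0 < T)
    (hs' : 0 < s') (hkG : k ≤ G) (hG : 30 * k / α ≤ G)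
    (hfail : k * (Real.exp (r * m - s / (2 * G)) + β' ^ r) +
      2 * ((G + 1) ^ k * (s ^ m * L + 1) ^ k : ℕ) ^ 2 * Real.exp (-2 * s' * (α / 15) ^ 2) ≤
        β / (2 * T))
    (hpriv : 2 * (((G + 1) ^ k * (s ^ m * L + 1) ^ k * t ^ k : ℕ) *
      (1 + (Real.exp (ε / 2) - 1) / δ)) / β ≤ Real.exp (ε * T / 2) - 1) :
    IsDPPACLearnableWith (mixLaw law k) (tvOn (mixLaw law k)) (T * (s + s')) ε δ α β := by
  classical
  have hCcount : Countable C := hCc.to_subtype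
  have hρ : 0 < α / 15 := by positivity
  have hC2 : IsLocallySmall (tvOn law) t (2 * (α / 15)) C := by
    rwa [mul_div_assoc']
  have ht : 0 < t := IsLocallySmall.pos (by linarith) hcov hC2
  obtain ⟨A, hA, hAdec⟩ := hdec
  obtain ⟨f₀⟩ := ‹Nonempty Θ›
  obtain ⟨c₀, hc₀, -⟩ := hcov f₀
  obtain ⟨W, hWne, hWcard, hW⟩ := exists_simplex_net hk hkG
  obtain ⟨w₀, hw₀⟩ := hWne
  set Y := RoundedList law C (α / 15) L t
  -- Rounding as post-processing of the decoder replaces its outputs by values in a countable type.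
  set round : ListUpTo L Θ → Y := fun l =>
    ⟨roundFinset law C ⟨c₀, hc₀⟩ (α / 15) l, roundFinset_spec hρ.le hcov hC2 _ l⟩ with hround
  have hroundm : Measurable round :=
    Measurable.subtype_mk (measurable_roundFinset hlaw hCc hρ.le hC2 _ L)
  have hAM : IsMarkovKernel (A.map round) := Kernel.IsMarkovKernel.map _ hroundm
  set claw : C → ProbabilityMeasure X := fun c => law c
  have hcard : Fintype.card (Fin s ⊕ Fin s') = s + s' := by simp
  rw [← hcard]
  have hG0 : (0 : ℝ) < G := by exact_mod_cast hk.trans_le hkG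
  refine isDPPACLearnableWith_of_finsetKernel (mixLaw law k) (tvOn (mixLaw law k)) hT
    (b := (G + 1) ^ k * (s ^ m * L + 1) ^ k * t ^ k) (by positivity) hε hδ hβ hpriv
    (measurableSet_not_tvOn_mixLaw_le hlaw k α)
    (fun h : Candidate W C => (h.1.1, fun i => (h.2 i).1)) (w₀, fun _ => f₀)
    (candidateKernel W claw (α / 15) (fun y : Y => y.1) ⟨c₀, hc₀⟩ (A.map round) s s') ?_
  intro f
  obtain ⟨v, hvW, hv1, hv2⟩ := hW f.1
  -- The cover points are chosen from `f` alone and hence are the same for all blocks.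
  choose c hcC hc using fun i => hcov (f.2 i)
  -- The net has error `2 * k / G`, which explains the requirement `30 * k / α ≤ G`.
  have hv : ∑ i, |f.1.1 i - v.1 i| ≤ α / 15 := by
    refine hv1.trans ?_
    rw [div_le_iff₀ hG0]
    rw [div_le_iff₀ hα] at hG
    linarith
  obtain ⟨h₀, key⟩ := candidateKernel_comp_le W (law := law) (claw := claw) hρ (pts := fun y : Y => y.1)
    (L := L) ht (fun y => y.2.1) (fun y p hp => (y.2.2 p hp).1) (fun y p hp => (y.2.2 p hp).2)
    ⟨c₀, hc₀⟩ (A.map round) hm s s' r hs' f ⟨v, hvW⟩ hv (fun i => ⟨c i, hcC i⟩) hv2 hβ'.le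
    fun i => by
      rw [← Measure.map_comp _ _ hroundm,
        Measure.map_apply hroundm (Set.to_countable _).measurableSet]
      -- Without contamination the second distribution is immaterial.
      have := hAdec (f.2 i) (law (f.2 i))
      simp only [huber_zero] at this
      refine (measure_mono fun l hl => ?_).trans this
      intro hex
      exact hl (exists_mem_roundFinset hρ.le hcov hC2 _ l hex (hc i))
  refine ⟨h₀, _, ?_, key.trans (ENNReal.ofReal_le_ofReal (le_trans ?_ hfail))⟩
  · rintro S ⟨h1, h2, h3⟩
    refine ⟨h1.trans (by gcongr), h2, fun h hh => ?_⟩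
    exact (h3 h hh).trans (by linarith)
  · have e : (r : ℝ) * m - 1 / G * s / 2 = r * m - s / (2 * G) := by field_simp
    rw [e]
    gcongr

end Reduction

/-! ### Choice of parameters and sample complexity -/

section Parameters

theorem exp_neg_le_inv {M y : ℝ} (hM : 0 < M) (h : Real.log M ≤ y) : Real.exp (-y) ≤ 1 / M := by
  rw [Real.exp_neg, ← one_div]
  exact one_div_le_one_div_of_le hM ((Real.log_le_iff_le_exp hM).1 h)

/-- Rounding a sample size up costs one unit of the constant, as long as the size has a factor at
least one. -/
theorem natCeil_le_add_one_mul {c y : ℝ} (hc : 0 ≤ c) (hy : 1 ≤ y) :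
    ((⌈c * y⌉₊ : ℕ) : ℝ) ≤ (c + 1) * y := by
  have := (Nat.ceil_lt_add_one (show 0 ≤ c * y by positivity)).le
  linarith

/-- A choice of the constants in the sizes of the samples. -/
theorem exists_sample_constants {a : ℝ} (ha : 0 < a) (p : ℕ) :
    ∃ v R σ x : ℝ, 0 ≤ v ∧ R = (v + 6) * a * 3 ^ p + 1 ∧ σ = 62 * (R + v + 6) + 1 ∧
      x = Real.log σ + p + 2 ∧ 0 ≤ x ∧ 2 * x + 17 ≤ Real.exp v - 1 := by
  -- The constants are circular: `exp v` bounds `T` from above and enters `R` and `σ` through `v`,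
  -- `σ` bounds `s`, and `x`, which controls `log s`, bounds `T` from below. But `log σ ≤ log K + v
  -- + 5`, so `2 * x + 17 ≤ 3 * v` for the `v` below, and `exp v - 1` exceeds this by its quadratic
  -- lower bound.
  set K : ℝ := 62 * (a * 3 ^ p + 2) + 1 with hK
  have hap : 0 < a * 3 ^ p := by positivity
  have hK1 : 1 ≤ K := by linarith
  have hlogK : 0 ≤ Real.log K := Real.log_nonneg hK1
  have hp : (0 : ℝ) ≤ p := Nat.cast_nonneg p
  set v : ℝ := 2 * Real.log K + 2 * p + 31 with hv
  have hv0 : 0 ≤ v := by positivity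
  refine ⟨v, _, _, _, hv0, rfl, rfl, rfl, ?_, ?_⟩
  · have : 0 ≤ Real.log (62 * ((v + 6) * a * 3 ^ p + 1 + v + 6) + 1) := by
      apply Real.log_nonneg
      have : 0 ≤ (v + 6) * a * 3 ^ p := by positivity
      linarith
    positivity
  · have h1 : Real.log (62 * ((v + 6) * a * 3 ^ p + 1 + v + 6) + 1) ≤ Real.log K + (v + 5) := by
      have h2 : 62 * ((v + 6) * a * 3 ^ p + 1 + v + 6) + 1 ≤ K * (v + 6) := by
        rw [hK]; nlinarith
      have h3 : Real.log (v + 6) ≤ v + 5 := by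
        have := Real.log_le_sub_one_of_pos (show 0 < v + 6 by linarith)
        linarith
      refine (Real.log_le_log (by positivity) h2).trans ?_
      rw [Real.log_mul (by positivity) (by positivity)]
      linarith
    have h2 := Real.quadratic_le_exp_of_nonneg hv0
    nlinarith

theorem log_six_le : Real.log 6 ≤ 2 := by
  rw [Real.log_le_iff_le_exp (by norm_num)]
  have := Real.exp_one_gt_d9
  have e : Real.exp 2 = Real.exp 1 * Real.exp 1 := by rw [← Real.exp_add]; norm_num
  rw [e]; nlinarith

theorem log_one_div (y : ℝ) : Real.log (1 / y) = -Real.log y := by rw [one_div, Real.log_inv]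

theorem log_one_div_nonneg {y : ℝ} (hy : 0 < y) (hy1 : y ≤ 1) : 0 ≤ Real.log (1 / y) :=
  Real.log_nonneg (by rwa [one_le_div hy])

/-- The two factors of the sample complexity of the reduction. -/
theorem exists_reductionComplexity_factors {t L m k : ℕ} (ht : 0 < t) (hL : 0 < L) (hm : 0 < m)
    (hk : 0 < k) {α β ε δ : ℝ} (hα : 0 < α) (hα1 : α < 1) (hβ : 0 < β) (hβ1 : β < 1) (hε : 0 < ε) :
    ∃ A B : ℝ, reductionComplexity t L m k α β ε δ = A * B ∧ 1 ≤ A ∧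
      (Real.log (1 / δ) + k * (Real.log t + Real.log L)) +
        (m * k + k * Real.log (1 / β)) / α ≤ ε * A ∧
      (m * k + k * Real.log (1 / β)) / α ≤ B ∧
      (m * k + k * Real.log (1 / β) + k * Real.log L) / α ^ 2 ≤ B := by
  have hL1 : (1 : ℝ) ≤ L := by exact_mod_cast hL
  have ht1 : (1 : ℝ) ≤ t := by exact_mod_cast ht
  have hlam0 := log_one_div_nonneg hβ hβ1.le
  have hlL0 : 0 ≤ Real.log L := Real.log_nonneg hL1
  have htL : Real.log (t * L) = Real.log t + Real.log L :=
    Real.log_mul (by positivity) (by positivity)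
  rw [reductionComplexity, htL]
  generalize Real.log (1 / δ) = d
  generalize Real.log (1 / β) = lam at *
  generalize Real.log L = lL at *
  refine ⟨_, _, rfl, le_max_left _ _, ?_, ?_, ?_⟩
  · refine le_trans (le_of_eq ?_) (mul_le_mul_of_nonneg_left (le_max_right _ _) hε.le)
    field_simp
  · have hpow3 : α ^ 3 ≤ α := by
      calc α ^ 3 ≤ α ^ 1 := pow_le_pow_of_le_one hα.le hα1.le (by norm_num)
        _ = α := pow_one α
    have h1 : (m * k + k * lam) / α ≤ (m * k + k * lam) / α ^ 3 := by gcongr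
    have h2 : 0 ≤ k * lL / α ^ 2 := by positivity
    linarith
  · have hpow32 : α ^ 3 ≤ α ^ 2 := pow_le_pow_of_le_one hα.le hα1.le (by norm_num)
    have h1 : (m * k + k * lam) / α ^ 2 ≤ (m * k + k * lam) / α ^ 3 := by gcongr
    rw [add_div]; linarith

theorem confidenceExponent_eq {t L m k : ℕ} (ht : 0 < t) (hL : 0 < L) {α β ε δ : ℝ} (hα : 0 < α)
    (hβ : 0 < β) (hδ : 0 < δ) :
    confidenceExponent t L m k α β ε δ = 1 + Real.log (1 / β) +
      Real.log (max 1 (m * k * (1 + (Real.log t + Real.log L + Real.log (1 / α)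
        + Real.log (1 / δ))) / ε)) := by
  have ht' : (t : ℝ) ≠ 0 := by exact_mod_cast ht.ne'
  have hL' : (L : ℝ) ≠ 0 := by exact_mod_cast hL.ne'
  have h1 : Real.log (t * L / (α * δ)) =
      Real.log t + Real.log L + Real.log (1 / α) + Real.log (1 / δ) := by
    rw [Real.log_div (by positivity) (by positivity), Real.log_mul ht' hL',
      Real.log_mul hα.ne' hδ.ne', log_one_div, log_one_div]
    ring
  rw [confidenceExponent, h1, Real.log_div (by positivity) hβ.ne', log_one_div β]
  generalize Real.log (max _ _) = y
  ring

/-- The confidence exponent is at most linear in the sample complexity. -/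
theorem log_confidenceExponent_le {t L m k : ℕ} (ht : 0 < t) (hL : 0 < L) (hm : 0 < m)
    (hk : 0 < k) {α β ε δ A B : ℝ} (hα : 0 < α) (hα1 : α < 1) (hβ : 0 < β) (hβ1 : β < 1)
    (hε : 0 < ε) (hδ : 0 < δ) (hδ1 : δ ≤ 1) (hA : 1 ≤ A)
    (hεA : (Real.log (1 / δ) + k * (Real.log t + Real.log L)) +
      (m * k + k * Real.log (1 / β)) / α ≤ ε * A)
    (hB : (m * k + k * Real.log (1 / β)) / α ≤ B) :
    Real.log (2 + confidenceExponent t L m k α β ε δ) ≤ 2 + Real.log (2 + A * B) := by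
  have hk1 : (1 : ℝ) ≤ k := by exact_mod_cast hk
  have hm1 : (1 : ℝ) ≤ m := by exact_mod_cast hm
  have hmk1 : (1 : ℝ) ≤ m * k := one_le_mul_of_one_le_of_one_le hm1 hk1
  have hlam0 := log_one_div_nonneg hβ hβ1.le
  have hd0 := log_one_div_nonneg hδ hδ1
  have hlL0 : 0 ≤ Real.log L := Real.log_nonneg (by exact_mod_cast hL)
  have hlt0 : 0 ≤ Real.log t := Real.log_nonneg (by exact_mod_cast ht)
  have hla : Real.log (1 / α) ≤ 1 / α - 1 := Real.log_le_sub_one_of_pos (by positivity)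
  have hla0 := log_one_div_nonneg hα hα1.le
  rw [confidenceExponent_eq ht hL hα hβ hδ]
  generalize Real.log (1 / β) = lam at *
  generalize Real.log (1 / δ) = d at *
  generalize Real.log L = lL at *
  generalize Real.log t = lt at *
  generalize Real.log (1 / α) = la at *
  have hkl : 0 ≤ k * lam := by positivity
  have hS : m * k + k * lam ≤ (m * k + k * lam) / α := by
    rw [le_div_iff₀ hα]; nlinarith
  have hSα : 1 / α ≤ (m * k + k * lam) / α := by gcongr; linarith
  have hktl : lt + lL ≤ k * (lt + lL) := le_mul_of_one_le_left (by positivity) hk1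
  have hB1 : 1 ≤ B := by linarith
  have hmkB : (m : ℝ) * k ≤ B := by linarith
  have hNB : B ≤ A * B := le_mul_of_one_le_left (by linarith) hA
  have h1 : m * k * (1 + (lt + lL + la + d)) / ε ≤ A * B := by
    rw [div_le_iff₀ hε]
    -- The term `log (1 / α)` is absorbed through `log (1 / α) ≤ 1 / α - 1`, with `1 / α` below the
    -- last summand of the bound on `ε * A`.
    have : 1 + (lt + lL + la + d) ≤ ε * A := by linarith
    calc m * k * (1 + (lt + lL + la + d)) ≤ B * (ε * A) := by gcongr
      _ = A * B * ε := by ring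
  have h2 : Real.log (max 1 (m * k * (1 + (lt + lL + la + d)) / ε)) ≤ A * B - 1 := by
    refine (Real.log_le_sub_one_of_pos (by positivity)).trans ?_
    have : max 1 (m * k * (1 + (lt + lL + la + d)) / ε) ≤ A * B := max_le (by linarith) h1
    linarith
  have h2' := Real.log_nonneg (le_max_left 1 (m * k * (1 + (lt + lL + la + d)) / ε : ℝ))
  have h3 : lam ≤ k * lam := le_mul_of_one_le_left hlam0 hk1
  generalize Real.log (max 1 (m * k * (1 + (lt + lL + la + d)) / ε)) = y at *
  have h4 : 2 + (1 + lam + y) ≤ 6 * (2 + A * B) := by linarith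
  refine (Real.log_le_log (by linarith) h4).trans ?_
  rw [Real.log_mul (by norm_num) (by positivity)]
  linarith [log_six_le]

/-- The number of blocks of samples of each component. -/
theorem exists_block_number {a v R l lam Λ lb : ℝ} {p : ℕ} (ha : 0 < a) (hv : 0 ≤ v)
    (hR : R = (v + 6) * a * 3 ^ p + 1) (hl : 1 ≤ l) (hlam : 0 ≤ lam) (hlb : 0 < lb)
    (hΛ1 : 1 + lam ≤ Λ) (hΛ : Λ ≤ a * lb * (3 * l) ^ p) :
    ∃ r : ℕ, (r : ℝ) ≤ R * l ^ (p + 1) ∧ (v + 5) * l + lam ≤ r * lb := by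
  have hl0 : 0 < l := by linarith
  -- The hypothesis on `Λ` is read as a lower bound for `lb`, the logarithm of `1 / β'`, and the
  -- target is at most `(v + 6) * l * Λ`.
  refine ⟨⌈(v + 6) * a * 3 ^ p * l ^ (p + 1)⌉₊, ?_, ?_⟩
  · have := natCeil_le_add_one_mul (show 0 ≤ (v + 6) * a * 3 ^ p by positivity)
      (one_le_pow₀ hl (n := p + 1))
    rwa [← hR] at this
  calc (v + 5) * l + lam
      ≤ (v + 6) * l * (1 + lam) := by
        have e2 : 1 * lam ≤ (v + 6) * l * lam := by
          gcongr
          exact one_le_mul_of_one_le_of_one_le (by linarith) hl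
        linarith
    _ ≤ (v + 6) * l * Λ := by gcongr
    _ ≤ (v + 6) * l * (a * lb * (3 * l) ^ p) := by gcongr
    _ = ((v + 6) * a * 3 ^ p * l ^ (p + 1)) * lb := by rw [mul_pow, pow_succ]; ring
    _ ≤ _ := by gcongr; exact Nat.le_ceil _

/-- The number of samples for list decoding. -/
theorem exists_decoding_sample_size {v R σ x l lam α S : ℝ} {p m k r G : ℕ} (hv : 0 ≤ v)
    (hR : 1 ≤ R) (hσ : σ = 62 * (R + v + 6) + 1) (hx : x = Real.log σ + p + 2) (hl : 1 ≤ l)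
    (hlam : 0 ≤ lam) (hα : 0 < α) (hm : 0 < m) (hG : 0 < G)
    (hGle : (G : ℝ) ≤ 31 * (k / α)) (hS : S = (m * k + k * lam) / α) (hS1 : 1 ≤ S)
    (hlogS : Real.log S ≤ l) (hlogl : Real.log l ≤ l) (hr : (r : ℝ) ≤ R * l ^ (p + 1)) :
    ∃ s : ℕ, (1 : ℝ) ≤ s ∧ (s : ℝ) ≤ σ * (l ^ (p + 1) * S) ∧ Real.log s ≤ x * l ∧
      r * m + ((v + 5) * l + lam) ≤ s / (2 * G) := by
  have hl0 : 0 < l := by linarith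
  have hm1 : (1 : ℝ) ≤ m := by exact_mod_cast hm
  have hG0 : (0 : ℝ) < G := by exact_mod_cast hG
  have hσ1 : 1 ≤ σ := by rw [hσ]; linarith
  have hlp : 1 ≤ l ^ (p + 1) := one_le_pow₀ hl
  have hllp : l ≤ l ^ (p + 1) := le_self_pow₀ hl (by omega)
  have hlS : 1 ≤ l ^ (p + 1) * S := one_le_mul_of_one_le_of_one_le hlp hS1
  -- Here `62 * (k / α)` is the bound for `2 * G`, and `S` is `k / α` times `m + lam`.
  have hsle := natCeil_le_add_one_mul (show 0 ≤ 62 * (R + v + 6) by positivity) hlS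
  rw [← hσ] at hsle
  have hsge : 62 * (R + v + 6) * (l ^ (p + 1) * S) ≤
      ((⌈62 * (R + v + 6) * (l ^ (p + 1) * S)⌉₊ : ℕ) : ℝ) := Nat.le_ceil _
  generalize (⌈62 * (R + v + 6) * (l ^ (p + 1) * S)⌉₊ : ℕ) = s at *
  have hs1 : (1 : ℝ) ≤ s := by
    refine le_trans ?_ hsge
    exact one_le_mul_of_one_le_of_one_le (by linarith) hlS
  refine ⟨s, hs1, hsle, ?_, ?_⟩
  · refine (Real.log_le_log (by linarith) hsle).trans ?_
    rw [Real.log_mul (by positivity) (by positivity), Real.log_mul (by positivity) (by positivity),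
      Real.log_pow, hx]
    have h2 : 0 ≤ Real.log σ := Real.log_nonneg hσ1
    have h3 : (0 : ℝ) ≤ p := Nat.cast_nonneg p
    push_cast
    have e1 : ((p : ℝ) + 1) * Real.log l ≤ ((p : ℝ) + 1) * l := by gcongr
    have e2 : Real.log σ * 1 ≤ Real.log σ * l := by gcongr
    linarith
  · have h1 : r * m + ((v + 5) * l + lam) ≤ (R + v + 6) * l ^ (p + 1) * (m + lam) := by
      have e1 : r * m ≤ R * l ^ (p + 1) * m := by gcongr
      have e2 : (v + 5) * l ≤ (v + 5) * l ^ (p + 1) := by gcongr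
      have e3 : (v + 5) * l ^ (p + 1) * 1 ≤ (v + 5) * l ^ (p + 1) * m := by gcongr
      have e4 : 1 * lam ≤ (R + v + 6) * l ^ (p + 1) * lam := by
        gcongr
        exact one_le_mul_of_one_le_of_one_le (by linarith) hlp
      have e5 : 0 ≤ l ^ (p + 1) * m := by positivity
      linarith
    rw [le_div_iff₀ (by positivity)]
    calc (r * m + ((v + 5) * l + lam)) * (2 * G)
        ≤ ((R + v + 6) * l ^ (p + 1) * (m + lam)) * (2 * (31 * (k / α))) := by gcongr
      _ = 62 * (R + v + 6) * (l ^ (p + 1) * S) := by rw [hS]; field_simp; ring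
      _ ≤ s := hsge

/-- The `s ^ m` runs enter only through `m * log s` per component. This is why running the decoder
on all tuples is affordable. -/
theorem log_card_mixtures_le {x l α : ℝ} {m k s G L : ℕ} (hl : 1 ≤ l) (hL : 0 < L) (hm : 0 < m)
    (hkα : 1 ≤ k / α) (hlogkα : Real.log (k / α) ≤ l) (hGle : (G : ℝ) ≤ 31 * (k / α))
    (hs1 : (1 : ℝ) ≤ s) (hlogs : Real.log s ≤ x * l) :
    Real.log (((G + 1) ^ k * (s ^ m * L + 1) ^ k : ℕ) : ℝ) ≤
      (x + 6) * l * (m * k) + k * Real.log L := by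
  have hL1 : (1 : ℝ) ≤ L := by exact_mod_cast hL
  have hm1 : (1 : ℝ) ≤ m := by exact_mod_cast hm
  have e1 : Real.log ((G : ℝ) + 1) ≤ 5 * l := by
    have h1 : (G : ℝ) + 1 ≤ 32 * (k / α) := by linarith
    refine (Real.log_le_log (by positivity) h1).trans ?_
    rw [Real.log_mul (by norm_num) (by positivity)]
    have h3 : Real.log 32 ≤ 4 := by
      have : (32 : ℝ) = 2 ^ 5 := by norm_num
      rw [this, Real.log_pow]
      have := Real.log_two_lt_d9
      push_cast; linarith
    linarith
  have e2 : Real.log ((s : ℝ) ^ m * L + 1) ≤ l + m * (x * l) + Real.log L := by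
    have h0 : 1 ≤ (s : ℝ) ^ m * L := one_le_mul_of_one_le_of_one_le (one_le_pow₀ hs1) hL1
    have h1 : (s : ℝ) ^ m * L + 1 ≤ 2 * (s ^ m * L) := by linarith
    refine (Real.log_le_log (by positivity) h1).trans ?_
    rw [Real.log_mul (by norm_num) (by positivity), Real.log_mul (by positivity) (by positivity),
      Real.log_pow]
    have h2 := Real.log_two_lt_d9
    have h3 : m * Real.log s ≤ m * (x * l) := by gcongr
    linarith
  push_cast
  rw [Real.log_mul (by positivity) (by positivity), Real.log_pow, Real.log_pow]
  have h4 : k * (6 * l) * 1 ≤ k * (6 * l) * m := by gcongr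
  calc k * Real.log ((G : ℝ) + 1) + k * Real.log ((s : ℝ) ^ m * L + 1)
      ≤ k * (5 * l) + k * (l + m * (x * l) + Real.log L) := by gcongr
    _ ≤ _ := by linarith

/-- The number of samples for testing. -/
theorem exists_test_sample_size {v x l α β lL : ℝ} {m k T M : ℕ} (hv : 0 ≤ v) (hx : 0 ≤ x)
    (hl : 1 ≤ l) (hα : 0 < α) (hα1 : α < 1) (hβ : 0 < β) (hlam : 0 ≤ Real.log (1 / β))
    (hlL : 0 ≤ lL) (hm : 0 < m) (hk : 0 < k) (hT : 0 < T) (hM : 0 < M)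
    (hlogT : Real.log T ≤ (v + 2) * l)
    (hlogM : Real.log M ≤ (x + 6) * l * (m * k) + k * lL) :
    ∃ s' : ℕ, 0 < s' ∧ (s' : ℝ) ≤ (113 * (v + 2 * x + 17) + 1) *
        (l * ((m * k + k * Real.log (1 / β) + k * lL) / α ^ 2)) ∧
      Real.log (12 * T * M ^ 2 / β) ≤ 2 * s' * (α / 15) ^ 2 := by
  have hT' : (0 : ℝ) < T := by exact_mod_cast hT
  have hM' : (0 : ℝ) < M := by exact_mod_cast hM
  have hk1 : (1 : ℝ) ≤ k := by exact_mod_cast hk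
  have hm1 : (1 : ℝ) ≤ m := by exact_mod_cast hm
  have hmk1 : (1 : ℝ) ≤ m * k := one_le_mul_of_one_le_of_one_le hm1 hk1
  have h12 : Real.log 12 ≤ 3 := by
    have : (12 : ℝ) = 2 * 6 := by norm_num
    rw [this, Real.log_mul (by norm_num) (by norm_num)]
    linarith [Real.log_two_lt_d9, log_six_le]
  have hlog : Real.log (12 * T * M ^ 2 / β) =
      Real.log 12 + Real.log T + 2 * Real.log M + Real.log (1 / β) := by
    rw [Real.log_div (by positivity) hβ.ne', Real.log_mul (by positivity) (by positivity),
      Real.log_mul (by positivity) (by positivity), Real.log_pow, log_one_div]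
    push_cast; ring
  rw [hlog]
  generalize Real.log (1 / β) = lam at *
  set D : ℝ := m * k + k * lam + k * lL with hD
  have hlam' : lam ≤ k * lam := le_mul_of_one_le_left hlam hk1
  have hklL : 0 ≤ k * lL := by positivity
  have hD1 : 1 ≤ D := by linarith
  have hDα : 1 ≤ D / α ^ 2 := by
    rw [one_le_div (by positivity)]
    exact (pow_le_one₀ hα.le hα1.le).trans hD1
  have hlD : 1 ≤ l * (D / α ^ 2) := one_le_mul_of_one_le_of_one_le hl hDα
  -- The constant `113` is the least integer with `2 * 113 ≥ 15 ^ 2`.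
  have hs'le := natCeil_le_add_one_mul (show 0 ≤ 113 * (v + 2 * x + 17) by positivity) hlD
  have hs'ge : 113 * (v + 2 * x + 17) * (l * (D / α ^ 2)) ≤
      ((⌈113 * (v + 2 * x + 17) * (l * (D / α ^ 2))⌉₊ : ℕ) : ℝ) := Nat.le_ceil _
  generalize (⌈113 * (v + 2 * x + 17) * (l * (D / α ^ 2))⌉₊ : ℕ) = s' at *
  have hs'0 : (0 : ℝ) < s' := lt_of_lt_of_le (by positivity) hs'ge
  refine ⟨s', by exact_mod_cast hs'0, hs'le, ?_⟩
  have h1 : Real.log 12 + Real.log T + 2 * Real.log M + lam ≤ (v + 2 * x + 17) * l * D := by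
    have e1 : (v + 5) * l * 1 ≤ (v + 5) * l * (m * k) := by gcongr
    have e2 : 1 * (k * lL) ≤ l * (k * lL) := by gcongr
    have e3 : 1 * (k * lam) ≤ l * (k * lam) := by gcongr
    have e4 : 0 ≤ (v + 2 * x + 15) * l * (k * lL) := by positivity
    have e5 : 0 ≤ (v + 2 * x + 16) * l * (k * lam) := by positivity
    rw [hD]
    linarith
  refine h1.trans ?_
  have h2 : 113 * (v + 2 * x + 17) * (l * (D / α ^ 2)) * (2 * (α / 15) ^ 2) ≤
      s' * (2 * (α / 15) ^ 2) := by gcongr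
  have h3 : 113 * (v + 2 * x + 17) * (l * (D / α ^ 2)) * (2 * (α / 15) ^ 2) =
      226 / 225 * ((v + 2 * x + 17) * l * D) := by field_simp; norm_num
  have h4 : 0 ≤ (v + 2 * x + 17) * l * D := by positivity
  linarith

/-- The failure probability on one data set. -/
theorem failure_probability_le {α β β' : ℝ} {m k s s' r G T M : ℕ} (hβ : 0 < β) (hβ' : 0 < β')
    (hk : 0 < k) (hT : 0 < T) (hM : 0 < M)
    (h₁ : r * m + Real.log (6 * k * T / β) ≤ s / (2 * G))
    (h₂ : Real.log (6 * k * T / β) ≤ r * Real.log (1 / β'))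
    (h₃ : Real.log (12 * T * M ^ 2 / β) ≤ 2 * s' * (α / 15) ^ 2) :
    k * (Real.exp (r * m - s / (2 * G)) + β' ^ r) +
      2 * (M : ℝ) ^ 2 * Real.exp (-2 * s' * (α / 15) ^ 2) ≤ β / (2 * T) := by
  have hk' : (0 : ℝ) < k := by exact_mod_cast hk
  have hT' : (0 : ℝ) < T := by exact_mod_cast hT
  have hM' : (0 : ℝ) < M := by exact_mod_cast hM
  have e1 : Real.exp (r * m - s / (2 * G)) ≤ 1 / (6 * k * T / β) := by
    have := exp_neg_le_inv (show 0 < 6 * k * T / β by positivity)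
      (show Real.log (6 * k * T / β) ≤ s / (2 * G) - r * m by linarith)
    rwa [neg_sub] at this
  have e2 : β' ^ r ≤ 1 / (6 * k * T / β) := by
    have := exp_neg_le_inv (show 0 < 6 * k * T / β by positivity) h₂
    have e : Real.exp (-(r * Real.log (1 / β'))) = β' ^ r := by
      rw [log_one_div, mul_neg, neg_neg, Real.exp_nat_mul, Real.exp_log hβ']
    rwa [e] at this
  have e3 : Real.exp (-2 * s' * (α / 15) ^ 2) ≤ 1 / (12 * T * M ^ 2 / β) := by
    have := exp_neg_le_inv (show 0 < 12 * T * M ^ 2 / β by positivity) h₃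
    convert this using 2
    ring
  -- The two decoding terms contribute `β / (3 * T)` together and the test contributes `β / (6 *
  -- T)`.
  calc k * (Real.exp (r * m - s / (2 * G)) + β' ^ r) +
        2 * (M : ℝ) ^ 2 * Real.exp (-2 * s' * (α / 15) ^ 2)
      ≤ k * (1 / (6 * k * T / β) + 1 / (6 * k * T / β)) +
        2 * (M : ℝ) ^ 2 * (1 / (12 * T * M ^ 2 / β)) := by gcongr
    _ = β / (2 * T) := by field_simp; norm_num

/-- The number of data sets suffices for the selection mechanism. -/
theorem selection_weight_le {β ε δ : ℝ} {b T : ℕ} (hβ : 0 < β) (hβ1 : β < 1)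
    (hε : 0 < ε) (hδ : 0 < δ) (hδ1 : δ ≤ 1) (hb : 0 < b)
    (h : Real.log 3 + Real.log b + Real.log (1 / δ) + Real.log (1 / β) + ε / 2 ≤ ε * T / 2) :
    2 * (b * (1 + (Real.exp (ε / 2) - 1) / δ)) / β ≤ Real.exp (ε * T / 2) - 1 := by
  have hb1 : (1 : ℝ) ≤ b := by exact_mod_cast hb
  have hδ' : 1 ≤ 1 / δ := by rwa [one_le_div hδ]
  have hβ' : 1 ≤ 1 / β := by rw [one_le_div hβ]; exact hβ1.le
  have hE1 : 1 ≤ Real.exp (ε / 2) := Real.one_le_exp (by positivity)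
  have h7 : 1 + (Real.exp (ε / 2) - 1) / δ ≤ Real.exp (ε / 2) * (1 / δ) := by
    have e : (Real.exp (ε / 2) - 1) / δ = Real.exp (ε / 2) * (1 / δ) - 1 / δ := by ring
    rw [e]; linarith
  have h8 : 3 * b * (1 / δ) * (1 / β) * Real.exp (ε / 2) ≤ Real.exp (ε * T / 2) := by
    have := Real.exp_le_exp.2 h
    rwa [Real.exp_add, Real.exp_add, Real.exp_add, Real.exp_add, Real.exp_log (by norm_num),
      Real.exp_log (by positivity), Real.exp_log (by positivity),
      Real.exp_log (by positivity)] at this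
  -- Of the three copies of this product, two form the required bound and the third pays for the `-
  -- 1`.
  have h9 : 1 ≤ b * (1 / δ) * (1 / β) * Real.exp (ε / 2) :=
    one_le_mul_of_one_le_of_one_le (one_le_mul_of_one_le_of_one_le
      (one_le_mul_of_one_le_of_one_le hb1 hδ') hβ') hE1
  calc 2 * (b * (1 + (Real.exp (ε / 2) - 1) / δ)) / β
      ≤ 2 * (b * (Real.exp (ε / 2) * (1 / δ))) / β := by gcongr
    _ = 3 * b * (1 / δ) * (1 / β) * Real.exp (ε / 2) -
        b * (1 / δ) * (1 / β) * Real.exp (ε / 2) := by ring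
    _ ≤ Real.exp (ε * T / 2) - 1 := by linarith

/-- All terms but `ε / 2` sum to at most `(x + 8) * l * (ε * A)`. Doubling gives `2 * x + 16`, and
the seventeenth unit pays for `ε / 2`. -/
theorem privacy_exponent_le {x l A α ε d lam lt lL lb : ℝ} {m k T : ℕ} (hx : 0 ≤ x) (hl : 1 ≤ l)
    (hA : 1 ≤ A) (hα : 0 < α) (hα1 : α < 1) (hε : 0 < ε) (hd : 0 ≤ d) (hlam : 0 ≤ lam)
    (hlt : 0 ≤ lt) (hlL : 0 ≤ lL) (hm : 0 < m) (hk : 0 < k)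
    (hεA : (d + k * (lt + lL)) + (m * k + k * lam) / α ≤ ε * A)
    (hlb : lb ≤ (x + 6) * l * (m * k) + k * lL + k * lt) (hT : (2 * x + 17) * (A * l) ≤ T) :
    Real.log 3 + lb + d + lam + ε / 2 ≤ ε * T / 2 := by
  have hk1 : (1 : ℝ) ≤ k := by exact_mod_cast hk
  have hm1 : (1 : ℝ) ≤ m := by exact_mod_cast hm
  have hmk1 : (1 : ℝ) ≤ m * k := one_le_mul_of_one_le_of_one_le hm1 hk1
  have h3 : Real.log 3 ≤ 2 := (Real.log_le_log (by norm_num) (by norm_num)).trans log_six_le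
  have hxl : 1 ≤ (x + 8) * l := one_le_mul_of_one_le_of_one_le (by linarith) hl
  have hlam' : lam ≤ k * lam := le_mul_of_one_le_left hlam hk1
  have hAl : 1 ≤ A * l := one_le_mul_of_one_le_of_one_le hA hl
  have h1 : Real.log 3 + lb + d + lam ≤
      (x + 8) * l * ((d + k * (lt + lL)) + (m * k + k * lam)) := by
    have e0 : 1 ≤ l * (m * k) := one_le_mul_of_one_le_of_one_le hl hmk1
    have e2 : 1 * (d + k * (lt + lL) + k * lam) ≤
        (x + 8) * l * (d + k * (lt + lL) + k * lam) := by gcongr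
    linarith
  have h2 : (d + k * (lt + lL)) + (m * k + k * lam) ≤ ε * A := by
    have e1 : m * k + k * lam ≤ (m * k + k * lam) / α := by
      rw [le_div_iff₀ hα]
      exact mul_le_of_le_one_right (by positivity) hα1.le
    linarith
  have h4 : ε * ((2 * x + 17) * (A * l)) ≤ ε * T := by gcongr
  have h5 : (x + 8) * l * ((d + k * (lt + lL)) + (m * k + k * lam)) ≤
      (x + 8) * l * (ε * A) := by gcongr
  have h6 : ε * 1 ≤ ε * (A * l) := by gcongr
  linarith

/-- The parameters of the reduction can be chosen with the claimed total number of samples. -/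
theorem exists_reduction_parameters {a : ℝ} (ha : 0 < a) (p : ℕ) :
    ∃ (C : ℝ) (q : ℕ), 0 < C ∧ ∀ (t L m k : ℕ) (_ : 0 < t) (_ : 0 < L) (_ : 0 < m) (_ : 0 < k)
      (α β β' ε δ : ℝ) (_ : 0 < α) (_ : α < 1) (_ : 0 < β) (_ : β < 1)
      (_ : 0 < β') (_ : β' < 1) (_ : 0 < ε) (_ : 0 < δ) (_ : δ ≤ 1)
      (_ : confidenceExponent t L m k α β ε δ ≤
        a * Real.log (1 / β') * Real.log (2 + confidenceExponent t L m k α β ε δ) ^ p),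
      ∃ T s s' r G : ℕ, 0 < T ∧ 0 < s' ∧ k ≤ G ∧ 30 * k / α ≤ G ∧
        k * (Real.exp (r * m - s / (2 * G)) + β' ^ r) +
          2 * ((G + 1) ^ k * (s ^ m * L + 1) ^ k : ℕ) ^ 2 *
            Real.exp (-2 * s' * (α / 15) ^ 2) ≤ β / (2 * T) ∧
        2 * (((G + 1) ^ k * (s ^ m * L + 1) ^ k * t ^ k : ℕ) *
          (1 + (Real.exp (ε / 2) - 1) / δ)) / β ≤ Real.exp (ε * T / 2) - 1 ∧
        ((T * (s + s') : ℕ) : ℝ) ≤ C * reductionComplexity t L m k α β ε δ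
            * Real.log (2 + reductionComplexity t L m k α β ε δ) ^ q := by
  obtain ⟨v, R, σ, x, hv, hR, hσ, hx, hx0, hvx⟩ := exists_sample_constants ha p
  have hR1 : 1 ≤ R := by
    rw [hR]
    have : 0 ≤ (v + 6) * a * 3 ^ p := by positivity
    linarith
  have hσ0 : 0 < σ := by rw [hσ]; linarith
  -- One logarithm comes from `T` and `p + 1` from `s`, so the exponent is `p + 2`.
  refine ⟨Real.exp v * (σ + (113 * (v + 2 * x + 17) + 1)), p + 2, by positivity, ?_⟩
  intro t L m k ht hL hm hk α β β' ε δ hα hα1 hβ hβ1 hβ' hβ'1 hε hδ hδ1 hΛ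
  obtain ⟨A, B, hN, hA, hεA, hSB, hDB⟩ :=
    exists_reductionComplexity_factors (δ := δ) ht hL hm hk hα hα1 hβ hβ1 hε
  have hΛ3 := log_confidenceExponent_le ht hL hm hk hα hα1 hβ hβ1 hε hδ hδ1 hA hεA hSB
  have hk1 : (1 : ℝ) ≤ k := by exact_mod_cast hk
  have hm1 : (1 : ℝ) ≤ m := by exact_mod_cast hm
  have hmk1 : (1 : ℝ) ≤ m * k := one_le_mul_of_one_le_of_one_le hm1 hk1
  have hlam := log_one_div_nonneg hβ hβ1.le
  have hd := log_one_div_nonneg hδ hδ1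
  have hlL : 0 ≤ Real.log L := Real.log_nonneg (by exact_mod_cast hL)
  have hlt : 0 ≤ Real.log t := Real.log_nonneg (by exact_mod_cast ht)
  have hΛ1 : 1 + Real.log (1 / β) ≤ confidenceExponent t L m k α β ε δ := by
    rw [confidenceExponent_eq ht hL hα hβ hδ]
    exact le_add_of_nonneg_right (Real.log_nonneg (le_max_left _ _))
  have hkα : 1 ≤ k / α := by rw [one_le_div hα]; linarith
  have hkS : k / α ≤ (m * k + k * Real.log (1 / β)) / α := by
    have : 0 ≤ k * Real.log (1 / β) := by positivity
    have : 1 * (k : ℝ) ≤ m * k := by gcongr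
    gcongr
    linarith
  have hS1 : 1 ≤ (m * k + k * Real.log (1 / β)) / α := hkα.trans hkS
  have hB1 : 1 ≤ B := hS1.trans hSB
  have hAN : A ≤ A * B := le_mul_of_one_le_right (by linarith) hB1
  have hBN : B ≤ A * B := le_mul_of_one_le_left (by linarith) hA
  rw [hN]
  obtain ⟨l, hl⟩ : ∃ l, l = Real.log (2 + A * B) := ⟨_, rfl⟩
  rw [← hl] at hΛ3 ⊢
  have hl1 : 1 ≤ l := by
    rw [hl, Real.le_log_iff_exp_le (by linarith)]
    linarith [Real.exp_one_lt_d9]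
  have hlog : ∀ y : ℝ, 0 < y → y ≤ 2 + A * B → Real.log y ≤ l := fun y hy h => by
    rw [hl]; exact Real.log_le_log hy h
  have hlN : l ≤ 2 + A * B := by
    rw [hl]
    have := Real.log_le_sub_one_of_pos (show 0 < 2 + A * B by linarith)
    linarith
  have hlogl : Real.log l ≤ l := hlog l (by linarith) hlN
  have hl0 : 0 < l := by linarith
  have hAl : 1 ≤ A * l := one_le_mul_of_one_le_of_one_le hA hl1
  obtain ⟨T, hTle, hTge⟩ : ∃ T : ℕ, (T : ℝ) ≤ Real.exp v * (A * l) ∧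
      (2 * x + 17) * (A * l) ≤ T := by
    refine ⟨⌈(Real.exp v - 1) * (A * l)⌉₊, ?_, le_trans (by gcongr) (Nat.le_ceil _)⟩
    have := natCeil_le_add_one_mul (show 0 ≤ Real.exp v - 1 by linarith) hAl
    rwa [sub_add_cancel] at this
  have hT1 : (1 : ℝ) ≤ T :=
    (one_le_mul_of_one_le_of_one_le (by linarith) hAl).trans hTge
  have hT0 : 0 < T := by exact_mod_cast (zero_lt_one.trans_le hT1)
  have hlogT : Real.log T ≤ (v + 2) * l := by
    refine (Real.log_le_log (by linarith) hTle).trans ?_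
    rw [Real.log_mul (by positivity) (by positivity), Real.log_exp,
      Real.log_mul (by positivity) (by positivity)]
    have h1 := hlog A (by linarith) (by linarith)
    have h2 : v * 1 ≤ v * l := by gcongr
    linarith
  have hQ : Real.log (6 * k * T / β) ≤ (v + 5) * l + Real.log (1 / β) := by
    have hlogk : Real.log k ≤ l := by
      refine hlog k (by linarith) ?_
      have : (k : ℝ) ≤ k / α := le_div_self (by linarith) hα hα1.le
      linarith
    rw [Real.log_div (by positivity) hβ.ne', Real.log_mul (by positivity) (by positivity),
      Real.log_mul (by positivity) (by positivity), log_one_div]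
    linarith [log_six_le]
  have hlogβ' : 0 < Real.log (1 / β') := Real.log_pos (by rw [one_lt_div hβ']; exact hβ'1)
  -- Since `1 ≤ l`, the bound `2 + l` on the logarithm of the confidence exponent is at most `3 *
  -- l`.
  have hΛl : confidenceExponent t L m k α β ε δ ≤ a * Real.log (1 / β') * (3 * l) ^ p := by
    refine hΛ.trans ?_
    have h1 : 0 ≤ Real.log (2 + confidenceExponent t L m k α β ε δ) :=
      Real.log_nonneg (by linarith)
    gcongr
    linarith
  obtain ⟨r, hrle, hrQ⟩ := exists_block_number ha hv hR hl1 hlam hlogβ' hΛ1 hΛl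
  obtain ⟨G, hGle, hGge⟩ : ∃ G : ℕ, (G : ℝ) ≤ 31 * (k / α) ∧ 30 * k / α ≤ G := by
    refine ⟨⌈30 * (k / α)⌉₊, ?_, ?_⟩
    · have := natCeil_le_add_one_mul (show (0 : ℝ) ≤ 30 by norm_num) hkα
      linarith
    · rw [mul_div_assoc]; exact Nat.le_ceil _
  have hkG : k ≤ G := by
    have : (k : ℝ) ≤ G := by
      refine le_trans ?_ hGge
      exact (le_div_self (by linarith) hα hα1.le).trans (by gcongr; linarith)
    exact_mod_cast this
  obtain ⟨s, hs1, hsle, hlogs, hsQ⟩ := exists_decoding_sample_size hv hR1 hσ hx hl1 hlam hα hm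
    (hk.trans_le hkG) hGle rfl hS1 (hlog _ (by linarith) (by linarith)) hlogl hrle
  have hlogM := log_card_mixtures_le hl1 hL hm hkα (hlog _ (by linarith) (by linarith)) hGle hs1
    hlogs
  have hM0 : 0 < (G + 1) ^ k * (s ^ m * L + 1) ^ k := by positivity
  obtain ⟨s', hs'0, hs'le, hs'Q⟩ := exists_test_sample_size hv hx0 hl1 hα hα1 hβ hlam hlL hm hk
    hT0 hM0 hlogT hlogM
  refine ⟨T, s, s', r, G, hT0, hs'0, hkG, hGge, ?_, ?_, ?_⟩
  · exact failure_probability_le hβ hβ' hk hT0 hM0 (by linarith) (hQ.trans hrQ) hs'Q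
  · refine selection_weight_le hβ hβ1 hε hδ hδ1 (by positivity)
      (privacy_exponent_le hx0 hl1 hA hα hα1 hε hd hlam hlt hlL hm hk hεA ?_ hTge)
    rw [Nat.cast_mul, Nat.cast_pow t, Real.log_mul (by positivity) (by positivity), Real.log_pow]
    linarith
  · push_cast
    have h1 : (s : ℝ) ≤ σ * (l ^ (p + 1) * B) := hsle.trans (by gcongr)
    have h2 : (s' : ℝ) ≤ (113 * (v + 2 * x + 17) + 1) * (l ^ (p + 1) * B) := by
      refine hs'le.trans ?_
      have : l ≤ l ^ (p + 1) := le_self_pow₀ hl1 (by omega)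
      gcongr
    calc (T : ℝ) * (s + s')
        ≤ Real.exp v * (A * l) * (σ * (l ^ (p + 1) * B) +
          (113 * (v + 2 * x + 17) + 1) * (l ^ (p + 1) * B)) := by gcongr
      _ = Real.exp v * (σ + (113 * (v + 2 * x + 17) + 1)) * (A * B) * l ^ (p + 2) := by ring

end Parameters
end

theorem theorem3p1 (a : ℝ) (ha : 0 < a) (p : ℕ) :
    ∃ (C : ℝ) (q : ℕ), 0 < C ∧
      ∀ (X : Type*) [MeasurableSpace X] [MeasurableSpace.CountablyGenerated X]
        (ν : Measure X) [SigmaFinite ν]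
        (F : Set (ProbabilityMeasure X)) (_ : F.Nonempty)
        (_ : ∀ f ∈ F, (f : Measure X) ≪ ν)
        (t L m k : ℕ) (_ : 0 < m) (_ : 0 < k)
        (α β β' ε δ : ℝ) (_ : 0 < α) (_ : α < 1) (_ : 0 < β) (_ : β < 1)
        (_ : 0 < β') (_ : β' < 1) (_ : 0 < ε) (_ : 0 < δ) (_ : δ ≤ 1)
        (_ : confidenceExponent t L m k α β ε δ ≤
          a * Real.log (1 / β') * Real.log (2 + confidenceExponent t L m k α β ε δ) ^ p)
        (_ : AdmitsLocallySmallCover (tvOn (Subtype.val : F → ProbabilityMeasure X))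
          t (2 * α / 15) (α / 15))
        (_ : IsListDecodable (Subtype.val : F → ProbabilityMeasure X)
          (tvOn (Subtype.val : F → ProbabilityMeasure X)) L m (α / 15) β' 0),
        ∃ n : ℕ,
          (n : ℝ) ≤ C * reductionComplexity t L m k α β ε δ
            * Real.log (2 + reductionComplexity t L m k α β ε δ) ^ q ∧
          IsDPPACLearnableWith (mixLaw (Subtype.val : F → ProbabilityMeasure X) k)
            (tvOn (mixLaw (Subtype.val : F → ProbabilityMeasure X) k)) n ε δ α β := by
  obtain ⟨C, q, hC, hpar⟩ := exists_reduction_parameters ha p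
  refine ⟨C, q, hC, ?_⟩
  intro X _ _ ν _ F hF hν t L m k hm hk α β β' ε δ hα hα1 hβ hβ1 hβ' hβ'1 hε hδ hδ1 hΛ hcover hdec
  obtain ⟨hρ, D, hDcov, hDsmall⟩ := hcover
  have hne : Nonempty F := hF.to_subtype
  have ht : 0 < t := IsLocallySmall.pos hρ hDcov hDsmall
  have hL : 0 < L := hdec.list_pos hβ'1 rfl
  obtain ⟨T, s, s', r, G, hpar⟩ :=
    hpar t L m k ht hL hm hk α β β' ε δ hα hα1 hβ hβ1 hβ' hβ'1 hε hδ hδ1 hΛ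
  -- The cover is not assumed countable; this is where domination by `ν` and the countably generated
  -- σ-algebra enter.
  have hDc : D.Countable :=
    by
    have h1 : ∀ f : F, ((f : ProbabilityMeasure X) : Measure X) ≪ ν := fun f => hν f.1 f.2
    have h2 : 0 < 2 * α / 15 := by linarith
    exact IsLocallySmall.countable (law := (Subtype.val : F → ProbabilityMeasure X)) ν h1 h2 hDsmall
  refine ⟨T * (s + s'), hpar.2.2.2.2.2.2, ?_⟩
  exact isDPPACLearnableWith_mixLaw measurable_subtype_coe hDc hm hk hα hβ hβ' hε
    hδ hDcov hDsmall hdec hpar.1 hpar.2.1 hpar.2.2.1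
    hpar.2.2.2.1 hpar.2.2.2.2.1 hpar.2.2.2.2.2.1
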